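/- **Theorem (Rate-distortion theorem for the average semantic distortion).** *Setting.* Concepts $c\in\mathcal C$ have a (discrete) law $P_C$. Given a concept $c$, an example $z=(x,y)\in\mathcal Z=\mathcal X\times\mathcal Y$ has the discrete law $p_c(x)\,p_c(y|x)$, and a dataset $s=(z_1,\dots,z_m)\in\mathcal S=\mathcal Z^m$ consists of $m$ independent examples of $c$; write $P_{C,S}$ for the resulting joint law and $P_S$ for the law of $S$. Let $\mathcal H$ be a finite set of models, let a learning algorithm map every dataset $s$ to a probability distribution $Q_{h|s}$ on $\mathcal H$ (Alice's belief), and let $\ell_c(h,z)\in[0,1]$ be a loss. For a distribution $Q$ on $\mathcal H$ let $\mathcal L_c(Q)=\mathbb E_{z\sim p_c}\,\mathbb E_{h\sim Q}[\ell_c(h,z)]$ be its true loss, and for two conditional distributions $Q_{h|s}$, $\hat Q_{h|s}$ let $$d_{sem}(Q,\hat Q)=\mathbb E_{(C,S)\sim P_{C,S}}\big[\mathcal L_C(\hat Q_{\cdot|S})-\mathcal L_C(Q_{\cdot|S})\big].$$ *Codes.* The pairs $(C_1,S_1),\dots,(C_n,S_n)$ are independent with law $P_{C,S}$. A $(2^{nR},n)$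 code consists of maps $f_n:\mathcal S^n\to\{1,\dots,\lfloor 2^{nR}\rfloor\}$ and $g_n:\{1,\dots,\lfloor 2^{nR}\rfloor\}\to\mathcal H^n$; put $\hat H^n=g_n(f_n(S^n))$ and let $\hat Q_i$ be the conditional distribution of $\hat H_i$ given $S_i$. The distortion of the code is $d_{avg}=\frac1n\sum_{i=1}^n d_{sem}(Q,\hat Q_i)$. A pair $(R,\varepsilon)\in\mathbb R^2$ is achievable if there is a sequence of $(2^{nR},n)$ codes, $n\to\infty$, whose distortions $d_{avg}$ converge to a limit $<\varepsilon$. The rate-distortion region is the closure of the set of achievable pairs, and the rate-distortion function $R(\varepsilon)$ is the infimum of the $R$ such that $(R,\varepsilon)$ lies in this region ($+\infty$ if there is no such $R$). *Claim.* For every $\varepsilon\in\mathbb R$, $$R(\varepsilon)=\min_{\tilde Q_{H|S}:\ d_{sem}(Q,\tilde Q)\le\varepsilon} I(S;H),$$ where $\tilde Q_{H|S}$ ranges over all conditional distributions on $\mathcal H$ given $S\in\mathcal S$ and $I(S;H)$ is the mutual information in bits of $S\sim P_S$ and $H\sim\tilde Q_{\cdot|S}$. The minimum is attained whenever some $\tilde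 Q_{H|S}$ satisfies the constraint; if none does, both sides are $+\infty$. -/

import Mathlib

open scoped ENNReal

namespace ConceptComm

universe u v w

/-! ### Discrete probability -/

/-- Expectation `𝔼_{a ∼ p}[f a]` under a discrete law `p`. -/
noncomputable def expect {α : Type u} (p : PMF α) (f : α → ℝ) : ℝ :=
  ∑' a, (p a).toReal * f a

theorem tsum_fin_prod {α : Type u} (p : PMF α) (n : ℕ) :
    ∑' x : Fin n → α, ∏ i, p (x i) = 1 := by
  induction n with
  | zero => simp
  | succ n ih =>
    rw [← (Fin.consEquiv fun _ : Fin (n + 1) => α).tsum_eq, ENNReal.tsum_prod']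
    simp only [Fin.consEquiv, Equiv.coe_fn_mk, Fin.prod_univ_succ, Fin.cons_zero, Fin.cons_succ]
    simp only [ENNReal.tsum_mul_left, ih, mul_one, p.tsum_coe]

/-- The law of `n` independent draws from `p`: the probability of `(x₁, …, xₙ)` is `∏ p(xᵢ)`. -/
noncomputable def iid {α : Type u} (p : PMF α) (n : ℕ) : PMF (Fin n → α) :=
  ⟨fun x => ∏ i, p (x i), tsum_fin_prod p n ▸ ENNReal.summable.hasSum⟩

/-- The joint law `p(a) k(b|a)` of a source `p` and a channel `k`. -/
noncomputable def joint {α : Type u} {β : Type v} (p : PMF α) (k : α → PMF β) : PMF (α × β) :=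
  p.bind fun a => (k a).map fun b => (a, b)

open Classical in
/-- The conditional law of the second coordinate given that the first one equals `a`.  It is an
arbitrary law (here the second marginal) if the first coordinate equals `a` with probability `0`. -/
noncomputable def condSnd {α : Type u} {β : Type v} (p : PMF (α × β)) (a : α) : PMF β :=
  if h : ∃ x ∈ {x : α × β | x.1 = a}, x ∈ p.support then
    (p.filter {x : α × β | x.1 = a} h).map Prod.snd
  else p.map Prod.snd

/-- The mutual information, in bits, between the two coordinates of a pair with law `p`:
`∑ p(a,b) log₂ (p(a,b) / (p(a) p(b)))`, where `0 log 0 = 0`. -/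
noncomputable def mutualInfo {α : Type u} {β : Type v} (p : PMF (α × β)) : ℝ :=
  ∑' x : α × β, (p x).toReal *
    Real.logb 2 ((p x).toReal / ((p.map Prod.fst x.1).toReal * (p.map Prod.snd x.2).toReal))

end ConceptComm

/-- The data of the problem of communicating concepts: concepts `c : C` with law `P_C`; examples
`z = (x, y)` distributed according to `p_c(x) p_c(y|x)`; datasets of `m` examples; a learning
algorithm, which maps a dataset `s` to the belief `Q_{h|s}` on the class `H` of models;
and the loss `ℓ_c(h, z) ∈ [0, 1]`. -/
structure ConceptProblem (C X Y H : Type*) (m : ℕ) where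
  conceptLaw : PMF C
  inputLaw : C → PMF X
  labelLaw : C → X → PMF Y
  learner : (Fin m → X × Y) → PMF H
  loss : C → H → X × Y → ℝ
  loss_nonneg : ∀ c h z, 0 ≤ loss c h z
  loss_le_one : ∀ c h z, loss c h z ≤ 1

namespace ConceptProblem

open ConceptComm

variable {C X Y H : Type*} {m : ℕ} (P : ConceptProblem C X Y H m)

/-- The law of one example of the concept `c`. -/
noncomputable def exampleLaw (c : C) : PMF (X × Y) :=
  joint (P.inputLaw c) (P.labelLaw c)

/-- The joint law of a concept `C` and its dataset `S`, which consists of `m` independent examples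
of the concept. -/
noncomputable def conceptDataLaw : PMF (C × (Fin m → X × Y)) :=
  joint P.conceptLaw fun c => iid (P.exampleLaw c) m

/-- The law `P_S` of the dataset. -/
noncomputable def dataLaw : PMF (Fin m → X × Y) :=
  P.conceptDataLaw.map Prod.snd

/-- The loss `ℓ_c(Q, z) = 𝔼_{h ∼ Q}[ℓ_c(h, z)]` of a belief `Q`. -/
noncomputable def beliefLoss (c : C) (Q : PMF H) (z : X × Y) : ℝ :=
  expect Q fun h => P.loss c h z

/-- The true loss `𝓛_c(Q) = 𝔼_{Z ∼ c}[ℓ_c(Q, Z)]` of a belief `Q`. -/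
noncomputable def trueLoss (c : C) (Q : PMF H) : ℝ :=
  expect (P.exampleLaw c) (P.beliefLoss c Q)

/-- The concept distortion `d_sem(Q, Q̂) = 𝔼_{C,S}[𝓛_C(Q̂_{·|S}) - 𝓛_C(Q_{·|S})]`. -/
noncomputable def dSem (Q Qhat : (Fin m → X × Y) → PMF H) : ℝ :=
  expect P.conceptDataLaw fun cs => P.trueLoss cs.1 (Qhat cs.2) - P.trueLoss cs.1 (Q cs.2)

/-- The average distortion `d_avg(Qⁿ, Q̂ⁿ) = (1/n) ∑ᵢ d_sem(Qᵢ, Q̂ᵢ)`. -/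
noncomputable def dAvg {n : ℕ} (Q Qhat : Fin n → (Fin m → X × Y) → PMF H) : ℝ :=
  (1 / (n : ℝ)) * ∑ i, P.dSem (Q i) (Qhat i)

end ConceptProblem

namespace ConceptComm

/-- A `(2^{nR}, n)` coding scheme for sequences of `n` letters of the alphabet `S`, with `n`
reconstruction letters in `H`; there are `⌊2^{nR}⌋` messages. -/
structure Code (S : Type*) (H : Type*) (R : ℝ) (n : ℕ) where
  encode : (Fin n → S) → Fin ⌊(2 : ℝ) ^ ((n : ℝ) * R)⌋₊
  decode : Fin ⌊(2 : ℝ) ^ ((n : ℝ) * R)⌋₊ → Fin n → H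

end ConceptComm

namespace ConceptProblem

open ConceptComm

variable {C X Y H : Type*} {m : ℕ} (P : ConceptProblem C X Y H m)

/-- The joint law `Q̂_{Sⁿ,Ĥⁿ}` of the `n` independent datasets and of the models that Bob
reconstructs with the given code. -/
noncomputable def inducedLaw {R : ℝ} {n : ℕ} (code : Code (Fin m → X × Y) H R n) :
    PMF ((Fin n → Fin m → X × Y) × (Fin n → H)) :=
  (iid P.dataLaw n).map fun s => (s, code.decode (code.encode s))

/-- The marginal `Q̂_{Sᵢ,Ĥᵢ}` of the `i`-th dataset and the `i`-th reconstructed model. -/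
noncomputable def inducedMarginal {R : ℝ} {n : ℕ} (code : Code (Fin m → X × Y) H R n)
    (i : Fin n) : PMF ((Fin m → X × Y) × H) :=
  (P.inducedLaw code).map fun sh => (sh.1 i, sh.2 i)

/-- Bob's `i`-th belief `Q̂ᵢ`: the conditional law of `Ĥᵢ` given `Sᵢ`. -/
noncomputable def inducedBelief {R : ℝ} {n : ℕ} (code : Code (Fin m → X × Y) H R n)
    (i : Fin n) : (Fin m → X × Y) → PMF H :=
  condSnd (P.inducedMarginal code i)

/-- The distortion `d_avg(Qⁿ, Q̂ⁿ)` of a code, where Alice's `i`-th belief is `Q_{h|sᵢ}`. -/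
noncomputable def codeDistortion {R : ℝ} {n : ℕ} (code : Code (Fin m → X × Y) H R n) : ℝ :=
  P.dAvg (fun _ => P.learner) (P.inducedBelief code)

/-- `(R, ε)` is achievable if the distortions of some sequence of `(2^{nR}, n)` coding schemes
converge to a limit less than `ε`. -/
def Achievable (R ε : ℝ) : Prop :=
  ∃ code : ∀ n : ℕ, Code (Fin m → X × Y) H R n, ∃ D < ε,
    Filter.Tendsto (fun n => P.codeDistortion (code n)) Filter.atTop (nhds D)

/-- The rate-distortion region: the closure of the set of achievable pairs. -/
def region : Set (ℝ × ℝ) :=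
  closure {p : ℝ × ℝ | P.Achievable p.1 p.2}

/-- The operational rate-distortion function: the infimum of the rates `R` with `(R, ε)` in the
rate-distortion region (`⊤` if there are none). -/
noncomputable def rateDistortion (ε : ℝ) : EReal :=
  sInf {r : EReal | ∃ R : ℝ, r = R ∧ (R, ε) ∈ P.region}

/-- The test channels `Q̃_{H|S}` with `d_sem(Q, Q̃) ≤ ε`, for `Q` the belief of Alice. -/
def testChannels (ε : ℝ) : Set ((Fin m → X × Y) → PMF H) :=
  {Qt | P.dSem P.learner Qt ≤ ε}

/-- The mutual information `I(S; H)` for `S ∼ P_S` and `H` the output of the test channel. -/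
noncomputable def channelInfo (Qt : (Fin m → X × Y) → PMF H) : ℝ :=
  mutualInfo (joint P.dataLaw Qt)

end ConceptProblem

/-!
The distortion is affine in Bob's belief: `d_sem(Q, Q̂)` is the expectation of a cost per letter
`δ(S, Ĥ)`, where `δ(s, h)` is the posterior mean of the true loss of the model `h` given the
dataset `s`, minus a constant that depends on `Q` alone (`ConceptProblem.dSem_eq`).  What remains is
the rate-distortion theorem for a discrete memoryless source, on a possibly infinite alphabet, with
a finite reconstruction alphabet and a bounded cost.

*Compactness.*  For a finite reconstruction alphabet, information and cost are uniformly convergent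
series of continuous functions on the set of channels, which is a compact product of simplices
(`continuousOn_infoNats`, `continuousOn_cost`).  Hence the minimum is attained, and approximate
solutions of the constraints yield exact ones (`exists_channel_of_approx`).  The same continuity
allows every channel to be replaced by a mixture with a little of the uniform channel; this keeps
all the logarithms bounded, so that only expectations of bounded functions occur.

*Achievability.*  Codewords are drawn from the output law of the channel.  A Chernoff bound shows
that the channel output typically has information density at most `n c₁`, for `c₁` slightly above
the information, and cost below the target; a change of measure then bounds the probability that
all codewords miss this event (`expect_not_covered_le`, `eventually_exists_code`).
The distortions of the codes must converge: a code that is too good is degraded letter by letter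
until it hits the target up to `1 / n` (`ConceptProblem.exists_code_near`).

*Converse.*  Let `w` be the average channel of a code with `M` messages, slightly mixed with the
uniform channel.  For each codeword the product of the densities `w(h | s) / w(h)` along the word
has mean `1`.  So the product along the reconstruction has mean at most `M`, and the mean of its
logarithm, which is essentially `n` times the information of `w`, is at most `log M`
(`mul_infoNats_le_log`).
-/

namespace ConceptComm

universe u v w

/-! ### Expectations of bounded functions -/

/-- A real function is bounded if its absolute values have a common bound. -/
def IsBdd {α : Type u} (f : α → ℝ) : Prop := ∃ B, ∀ x, |f x| ≤ B

section IsBdd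

variable {α : Type u} {β : Type v} {ι : Type w} {f g : α → ℝ}

theorem IsBdd.const (c : ℝ) : IsBdd fun _ : α => c := ⟨|c|, fun _ => le_rfl⟩

theorem IsBdd.of_mem_Icc {a b : ℝ} (h : ∀ x, a ≤ f x ∧ f x ≤ b) : IsBdd f :=
  ⟨max |a| |b|, fun x => abs_le_max_abs_abs (h x).1 (h x).2⟩

theorem IsBdd.comp (hf : IsBdd f) (k : β → α) : IsBdd fun x => f (k x) :=
  hf.imp fun _ hB x => hB (k x)

theorem IsBdd.add (hf : IsBdd f) (hg : IsBdd g) : IsBdd fun x => f x + g x := by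
  obtain ⟨A, hA⟩ := hf
  obtain ⟨B, hB⟩ := hg
  exact ⟨A + B, fun x => (abs_add_le _ _).trans (add_le_add (hA x) (hB x))⟩

theorem IsBdd.mul (hf : IsBdd f) (hg : IsBdd g) : IsBdd fun x => f x * g x := by
  obtain ⟨A, hA⟩ := hf
  obtain ⟨B, hB⟩ := hg
  refine ⟨A * B, fun x => ?_⟩
  rw [abs_mul]
  exact mul_le_mul (hA x) (hB x) (abs_nonneg _) ((abs_nonneg _).trans (hA x))

theorem IsBdd.neg (hf : IsBdd f) : IsBdd fun x => -f x := by
  simpa [IsBdd] using hf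

theorem IsBdd.sub (hf : IsBdd f) (hg : IsBdd g) : IsBdd fun x => f x - g x := by
  simpa only [sub_eq_add_neg] using hf.add hg.neg

theorem IsBdd.sum {s : Finset ι} {F : ι → α → ℝ} (h : ∀ i ∈ s, IsBdd (F i)) :
    IsBdd fun x => ∑ i ∈ s, F i x := by
  classical
  induction s using Finset.induction_on with
  | empty => simpa using IsBdd.const 0
  | insert i s hi ih =>
    simp only [Finset.sum_insert hi]
    exact (h i (by simp)).add (ih fun j hj => h j (by simp [hj]))

theorem IsBdd.prod {s : Finset ι} {F : ι → α → ℝ} (h : ∀ i ∈ s, IsBdd (F i)) :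
    IsBdd fun x => ∏ i ∈ s, F i x := by
  classical
  induction s using Finset.induction_on with
  | empty => simpa using IsBdd.const 1
  | insert i s hi ih =>
    simp only [Finset.prod_insert hi]
    exact (h i (by simp)).mul (ih fun j hj => h j (by simp [hj]))

end IsBdd

section expect

variable {α : Type u} {β : Type v} {ι : Type w} {f g : α → ℝ} (p : PMF α)

theorem summable_toReal_pmf : Summable fun a => (p a).toReal :=
  ENNReal.summable_toReal p.tsum_coe_ne_top

theorem tsum_toReal_pmf : ∑' a, (p a).toReal = 1 := by
  rw [← ENNReal.tsum_toReal_eq p.apply_ne_top, p.tsum_coe, ENNReal.toReal_one]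

variable {p}

theorem IsBdd.summable (hf : IsBdd f) : Summable fun a => (p a).toReal * f a := by
  obtain ⟨B, hB⟩ := hf
  refine Summable.of_norm_bounded ((summable_toReal_pmf p).mul_right B) fun a => ?_
  rw [norm_mul, Real.norm_eq_abs, Real.norm_eq_abs, abs_of_nonneg ENNReal.toReal_nonneg]
  exact mul_le_mul_of_nonneg_left (hB a) ENNReal.toReal_nonneg

theorem expect_const (c : ℝ) : expect p (fun _ => c) = c := by
  rw [expect, tsum_mul_right, tsum_toReal_pmf, one_mul]

theorem expect_add (hf : IsBdd f) (hg : IsBdd g) :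
    expect p (fun a => f a + g a) = expect p f + expect p g := by
  simp only [expect, mul_add]
  exact hf.summable.tsum_add hg.summable

theorem expect_const_mul (c : ℝ) : expect p (fun a => c * f a) = c * expect p f := by
  simp only [expect, mul_left_comm _ c, tsum_mul_left]

theorem expect_sub (hf : IsBdd f) (hg : IsBdd g) :
    expect p (fun a => f a - g a) = expect p f - expect p g := by
  simp only [expect, mul_sub]
  exact hf.summable.tsum_sub hg.summable

theorem expect_sum {s : Finset ι} {F : ι → α → ℝ} (h : ∀ i ∈ s, IsBdd (F i)) :
    expect p (fun a => ∑ i ∈ s, F i a) = ∑ i ∈ s, expect p (F i) := by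
  simp only [expect, Finset.mul_sum]
  exact Summable.tsum_finsetSum fun i hi => (h i hi).summable

/-- Monotonicity of the expectation; the inequality is only needed on the support. -/
theorem expect_mono (hf : IsBdd f) (hg : IsBdd g) (h : ∀ a, p a ≠ 0 → f a ≤ g a) :
    expect p f ≤ expect p g := by
  refine hf.summable.tsum_le_tsum (fun a => ?_) hg.summable
  by_cases ha : p a = 0
  · simp [ha]
  · exact mul_le_mul_of_nonneg_left (h a ha) ENNReal.toReal_nonneg

theorem expect_nonneg (h : ∀ a, 0 ≤ f a) : 0 ≤ expect p f :=
  tsum_nonneg fun a => mul_nonneg ENNReal.toReal_nonneg (h a)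

theorem expect_mem_Icc {c d : ℝ} (h : ∀ a, c ≤ f a ∧ f a ≤ d) :
    c ≤ expect p f ∧ expect p f ≤ d := by
  have hf := IsBdd.of_mem_Icc h
  constructor
  · simpa [expect_const] using expect_mono (p := p) (IsBdd.const c) hf fun a _ => (h a).1
  · simpa [expect_const] using expect_mono (p := p) hf (IsBdd.const d) fun a _ => (h a).2

theorem expect_fintype [Fintype α] : expect p f = ∑ a, (p a).toReal * f a := tsum_fintype _

theorem expect_pure (a : α) : expect (PMF.pure a) f = f a := by
  rw [expect, tsum_eq_single a]
  · simp
  · intro b hb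
    simp [PMF.pure_apply, hb]

/-- The law of total expectation. -/
theorem expect_bind {k : α → PMF β} {F : β → ℝ} (hF : IsBdd F) :
    expect (p.bind k) F = expect p fun a => expect (k a) F := by
  obtain ⟨B, hB⟩ := hF
  have h1 : Summable fun x : α × β => (p x.1 * k x.1 x.2).toReal := by
    refine ENNReal.summable_toReal ?_
    rw [ENNReal.tsum_prod']
    simp [ENNReal.tsum_mul_left]
  have h2 : Summable fun x : α × β => (p x.1 * k x.1 x.2).toReal * F x.2 := by
    refine Summable.of_norm_bounded (h1.mul_right B) fun x => ?_
    rw [norm_mul, Real.norm_eq_abs, Real.norm_eq_abs, abs_of_nonneg ENNReal.toReal_nonneg]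
    exact mul_le_mul_of_nonneg_left (hB _) ENNReal.toReal_nonneg
  have h3 : ∀ b, ((p.bind k) b).toReal * F b = ∑' a, (p a * k a b).toReal * F b := by
    intro b
    rw [PMF.bind_apply, ENNReal.tsum_toReal_eq, tsum_mul_right]
    exact fun a => ENNReal.mul_ne_top (p.apply_ne_top a) ((k a).apply_ne_top b)
  simp only [expect, h3]
  rw [Summable.tsum_comm (f := fun a b => (p a * k a b).toReal * F b) h2]
  simp only [ENNReal.toReal_mul, mul_assoc, tsum_mul_left]

theorem expect_map {k : α → β} {F : β → ℝ} (hF : IsBdd F) :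
    expect (p.map k) F = expect p fun a => F (k a) := by
  rw [PMF.map, expect_bind hF]
  simp only [Function.comp_apply, expect_pure]

theorem expect_joint {k : α → PMF β} {F : α × β → ℝ} (hF : IsBdd F) :
    expect (joint p k) F = expect p fun a => expect (k a) fun b => F (a, b) := by
  rw [joint, expect_bind hF]
  simp only [expect_map hF]

theorem pmf_ext_of_expect {q : PMF α} (h : ∀ f : α → ℝ, IsBdd f → expect p f = expect q f) :
    p = q := by
  classical
  have key : ∀ (r : PMF α) (a : α), expect r (Pi.single a 1) = (r a).toReal := by
    intro r a
    rw [expect, tsum_eq_single a]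
    · simp
    · intro b hb
      simp [hb]
  ext a
  rw [← ENNReal.toReal_eq_toReal_iff' (p.apply_ne_top a) (q.apply_ne_top a), ← key, ← key]
  refine h _ (.of_mem_Icc (a := 0) (b := 1) fun x => ?_)
  by_cases hx : x = a
  · subst hx; simp
  · simp [hx]

theorem joint_apply (k : α → PMF β) (a : α) (b : β) : joint p k (a, b) = p a * k a b := by
  classical
  rw [joint, PMF.bind_apply, tsum_eq_single a]
  · rw [PMF.map_apply, tsum_eq_single b]
    · simp
    · intro b' hb'
      simp [hb'.symm]
  · intro a' ha'
    rw [PMF.map_apply]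
    simp [ha'.symm]

theorem map_fst_joint (k : α → PMF β) : (joint p k).map Prod.fst = p := by
  refine pmf_ext_of_expect fun f hf => ?_
  rw [expect_map hf, expect_joint (hf.comp Prod.fst)]
  simp only [expect_const]

/-- Disintegration of a law into its first marginal and the conditional law of the second
coordinate. -/
theorem joint_map_fst_condSnd (r : PMF (α × β)) : joint (r.map Prod.fst) (condSnd r) = r := by
  classical
  have hfst : ∀ a, r.map Prod.fst a = ∑' x, {x : α × β | x.1 = a}.indicator r x := by
    intro a
    rw [PMF.map_apply]
    refine tsum_congr fun x => ?_
    simp [Set.indicator_apply, eq_comm]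
  ext ⟨a, b⟩
  rw [joint_apply]
  by_cases h : ∃ x ∈ {x : α × β | x.1 = a}, x ∈ r.support
  · have hne : r.map Prod.fst a ≠ 0 := by
      obtain ⟨x, hx, hxs⟩ := h
      rw [← PMF.mem_support_iff, PMF.mem_support_map_iff]
      exact ⟨x, hxs, hx⟩
    rw [condSnd, dif_pos h, PMF.map_apply (f := Prod.snd), tsum_eq_single (a, b)]
    · rw [PMF.filter_apply, ← hfst]
      simp only [if_true, Set.indicator_apply, Set.mem_ofPred_eq]
      rw [mul_comm, mul_assoc, ENNReal.inv_mul_cancel hne (PMF.apply_ne_top _ _), mul_one]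
    · rintro ⟨a', b'⟩ hx
      split_ifs with hb
      · refine PMF.filter_apply_eq_zero_of_notMem _ ?_
        simp_all
      · rfl
  · have h0 : r (a, b) = 0 := by
      by_contra h0
      exact h ⟨(a, b), rfl, h0⟩
    have h1 : r.map Prod.fst a = 0 := by
      rw [hfst, ENNReal.tsum_eq_zero]
      intro x
      rw [Set.indicator_apply]
      split_ifs with hx
      · by_contra hx0
        exact h ⟨x, hx, hx0⟩
      · rfl
    rw [h0, h1, zero_mul]

/-! ### Independent draws -/

theorem iid_succ (p : PMF α) (n : ℕ) :
    iid p (n + 1) = p.bind fun a => (iid p n).map (Fin.cons a) := by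
  classical
  have key : ∀ (n : ℕ) (x : Fin n → α), iid p n x = ∏ i, p (x i) := fun _ _ => rfl
  ext x
  rw [PMF.bind_apply, tsum_eq_single (x 0)]
  · rw [PMF.map_apply, tsum_eq_single (Fin.tail x)]
    · rw [if_pos (Fin.cons_self_tail x).symm, key, key, Fin.prod_univ_succ]
      rfl
    · intro y hy
      rw [if_neg]
      intro h
      exact hy (by rw [h, Fin.tail_cons])
  · intro a ha
    rw [PMF.map_apply]
    simp only [mul_eq_zero, ENNReal.tsum_eq_zero]
    right
    intro y
    rw [if_neg]
    intro h
    exact ha (by rw [h, Fin.cons_zero])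

/-- Expectations of products of functions of independent variables factorize. -/
theorem expect_iid_prod {n : ℕ} {F : Fin n → α → ℝ} (hF : ∀ i, IsBdd (F i)) :
    expect (iid p n) (fun x => ∏ i, F i (x i)) = ∏ i, expect p (F i) := by
  induction n with
  | zero => simpa using expect_const 1
  | succ n ih =>
    have hb : IsBdd fun x : Fin (n + 1) → α => ∏ i, F i (x i) :=
      IsBdd.prod fun i _ => (hF i).comp fun x : Fin (n + 1) → α => x i
    rw [iid_succ, expect_bind hb]
    simp only [expect_map hb]
    simp only [Fin.prod_univ_succ, Fin.cons_zero, Fin.cons_succ, expect_const_mul]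
    rw [ih fun i => hF i.succ]
    simp only [mul_comm _ (∏ i : Fin n, expect p (F i.succ)), expect_const_mul]

theorem map_eval_iid (n : ℕ) (i : Fin n) : (iid p n).map (fun x : Fin n → α => x i) = p := by
  refine pmf_ext_of_expect fun f hf => ?_
  rw [expect_map hf]
  have h := expect_iid_prod (p := p) (F := fun j => if j = i then f else fun _ => 1) (n := n)
    fun j => by split_ifs; exacts [hf, .const 1]
  have h1 : ∀ (j : Fin n) (a : α), (if j = i then f else fun _ => 1) a = if j = i then f a else 1 :=
    fun j a => by split_ifs <;> rfl
  have h2 : ∀ j : Fin n, expect p (if j = i then f else fun _ => 1) =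
      if j = i then expect p f else 1 := fun j => by
    split_ifs <;> simp [expect_const]
  simpa [h1, h2] using h

theorem expect_iid_eval {n : ℕ} (i : Fin n) (hf : IsBdd f) :
    expect (iid p n) (fun x => f (x i)) = expect p f := by
  rw [← expect_map (k := fun x : Fin n → α => x i) hf, map_eval_iid]

end expect

/-! ### Channels, their information and their cost -/

section channels

variable {S : Type u} {H : Type v} [Fintype H] {p : PMF S} {q δ : S → H → ℝ}

/-- The channels from `S` to the finite alphabet `H`, as real matrices whose rows lie in the
standard simplex; with the topology of pointwise convergence this set is compact. -/
def channels (S : Type u) (H : Type v) [Fintype H] : Set (S → H → ℝ) :=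
  Set.univ.pi fun _ => stdSimplex ℝ H

theorem isCompact_channels : IsCompact (channels S H) :=
  isCompact_univ_pi fun _ => isCompact_stdSimplex ℝ H

theorem channel_nonneg (hq : q ∈ channels S H) (s : S) (h : H) : 0 ≤ q s h :=
  (hq s trivial).1 h

theorem channel_sum (hq : q ∈ channels S H) (s : S) : ∑ h, q s h = 1 :=
  (hq s trivial).2

theorem channel_le_one (hq : q ∈ channels S H) (s : S) (h : H) : q s h ≤ 1 := by
  rw [← channel_sum hq s]
  exact Finset.single_le_sum (fun i _ => channel_nonneg hq s i) (Finset.mem_univ h)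

theorem channel_mem_Icc (hq : q ∈ channels S H) (s : S) (h : H) : 0 ≤ q s h ∧ q s h ≤ 1 :=
  ⟨channel_nonneg hq s h, channel_le_one hq s h⟩

theorem isBdd_channel (hq : q ∈ channels S H) (h : H) : IsBdd fun s => q s h :=
  .of_mem_Icc fun s => channel_mem_Icc hq s h

theorem toReal_mem_channels (Q : S → PMF H) : (fun s h => (Q s h).toReal) ∈ channels S H :=
  fun s _ => ⟨fun _ => ENNReal.toReal_nonneg, by
    rw [← tsum_fintype (L := .unconditional H)]
    exact tsum_toReal_pmf (Q s)⟩

theorem exists_pmf_of_mem_channels (hq : q ∈ channels S H) :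
    ∃ Q : S → PMF H, (fun s h => (Q s h).toReal) = q := by
  refine ⟨fun s => PMF.ofFintype (fun h => ENNReal.ofReal (q s h)) ?_, ?_⟩
  · rw [← ENNReal.ofReal_sum_of_nonneg fun h _ => channel_nonneg hq s h, channel_sum hq,
      ENNReal.ofReal_one]
  · funext s h
    rw [PMF.ofFintype_apply, ENNReal.toReal_ofReal (channel_nonneg hq s h)]

/-- The law of the output of the channel `q` with input law `p`. -/
noncomputable def outLaw (p : PMF S) (q : S → H → ℝ) (h : H) : ℝ := expect p fun s => q s h

/-- The mutual information, in nats, between the input `S ∼ p` and the output of the channel `q`. -/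
noncomputable def infoNats (p : PMF S) (q : S → H → ℝ) : ℝ :=
  expect p fun s => ∑ h, q s h * (Real.log (q s h) - Real.log (outLaw p q h))

/-- The expected cost `δ(S, H)` of the input `S ∼ p` and the output `H` of the channel `q`. -/
noncomputable def cost (p : PMF S) (δ q : S → H → ℝ) : ℝ :=
  expect p fun s => ∑ h, q s h * δ s h

theorem outLaw_mem_Icc (hq : q ∈ channels S H) (h : H) : 0 ≤ outLaw p q h ∧ outLaw p q h ≤ 1 :=
  expect_mem_Icc fun s => channel_mem_Icc hq s h

theorem sum_outLaw (hq : q ∈ channels S H) : ∑ h, outLaw p q h = 1 := by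
  simp only [outLaw]
  rw [← expect_sum fun h _ => isBdd_channel hq h]
  simp only [channel_sum hq, expect_const]

theorem abs_mul_log_le_one {x : ℝ} (h0 : 0 ≤ x) (h1 : x ≤ 1) : |x * Real.log x| ≤ 1 := by
  rcases h0.eq_or_lt with rfl | h0
  · simp
  · rw [mul_comm]
    exact (Real.abs_log_mul_self_lt x h0 h1).le

theorem isBdd_channel_mul_log (hq : q ∈ channels S H) (h : H) :
    IsBdd fun s => q s h * Real.log (q s h) :=
  ⟨1, fun s => abs_mul_log_le_one (channel_nonneg hq s h) (channel_le_one hq s h)⟩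

/-- The mutual information is the entropy of the output minus the conditional entropy of the
output given the input. -/
theorem infoNats_eq (hq : q ∈ channels S H) :
    infoNats p q = (expect p fun s => ∑ h, q s h * Real.log (q s h)) -
      ∑ h, outLaw p q h * Real.log (outLaw p q h) := by
  simp only [infoNats, mul_sub, Finset.sum_sub_distrib]
  have h1 : ∀ h, IsBdd fun s => q s h * Real.log (outLaw p q h) := fun h =>
    (isBdd_channel hq h).mul (.const _)
  rw [expect_sub (.sum fun h _ => isBdd_channel_mul_log hq h) (.sum fun h _ => h1 h),
    expect_sum fun h _ => h1 h]
  congr 1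
  refine Finset.sum_congr rfl fun h _ => ?_
  simp only [mul_comm _ (Real.log (outLaw p q h)), expect_const_mul]
  rfl

theorem continuousOn_expect {T : Type w} [TopologicalSpace T] {K : Set T} {F : T → S → ℝ} {B : ℝ}
    (hB : ∀ t ∈ K, ∀ s, |F t s| ≤ B) (hc : ∀ s, ContinuousOn (fun t => F t s) K) :
    ContinuousOn (fun t => expect p (F t)) K := by
  refine continuousOn_tsum (fun s => continuousOn_const.mul (hc s))
    ((summable_toReal_pmf p).mul_right B) fun s t ht => ?_
  rw [norm_mul, Real.norm_eq_abs, Real.norm_eq_abs, abs_of_nonneg ENNReal.toReal_nonneg]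
  exact mul_le_mul_of_nonneg_left (hB t ht s) ENNReal.toReal_nonneg

theorem continuous_channel_apply {ι : Type w} (s : S) (h : ι) :
    Continuous fun q : S → ι → ℝ => q s h :=
  (continuous_apply h).comp (continuous_apply s)

theorem continuousOn_infoNats : ContinuousOn (infoNats p) (channels S H) := by
  refine ContinuousOn.congr (f := fun q => (expect p fun s => ∑ h, q s h * Real.log (q s h)) -
      ∑ h, outLaw p q h * Real.log (outLaw p q h)) ?_ fun q hq => infoNats_eq hq
  refine .sub (continuousOn_expect (B := ∑ _h : H, 1) (fun q hq s => ?_) fun s => ?_) ?_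
  · refine (Finset.abs_sum_le_sum_abs _ _).trans (Finset.sum_le_sum fun h _ => ?_)
    exact abs_mul_log_le_one (channel_nonneg hq s h) (channel_le_one hq s h)
  · exact (continuous_finsetSum _ fun h _ =>
      Real.continuous_mul_log.comp (continuous_channel_apply s h)).continuousOn
  · refine continuousOn_finsetSum _ fun h _ => Real.continuous_mul_log.comp_continuousOn ?_
    refine continuousOn_expect (B := 1) (fun q hq s => ?_) fun s =>
      (continuous_channel_apply s h).continuousOn
    rw [abs_of_nonneg (channel_nonneg hq s h)]
    exact channel_le_one hq s h

theorem channel_sum_mul_mem_Icc (hq : q ∈ channels S H) {s : S} {f : H → ℝ} {a b : ℝ}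
    (hf : ∀ h, a ≤ f h ∧ f h ≤ b) : a ≤ ∑ h, q s h * f h ∧ ∑ h, q s h * f h ≤ b := by
  constructor
  · calc a = ∑ h, q s h * a := by rw [← Finset.sum_mul, channel_sum hq, one_mul]
      _ ≤ _ := Finset.sum_le_sum fun h _ =>
        mul_le_mul_of_nonneg_left (hf h).1 (channel_nonneg hq s h)
  · calc _ ≤ ∑ h, q s h * b := Finset.sum_le_sum fun h _ =>
        mul_le_mul_of_nonneg_left (hf h).2 (channel_nonneg hq s h)
      _ = b := by rw [← Finset.sum_mul, channel_sum hq, one_mul]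

theorem continuousOn_cost (hδ : ∀ s h, 0 ≤ δ s h ∧ δ s h ≤ 1) :
    ContinuousOn (cost p δ) (channels S H) := by
  refine continuousOn_expect (B := 1) (fun q hq s => ?_) fun s => ?_
  · have := channel_sum_mul_mem_Icc hq (s := s) (hδ s)
    exact abs_le.2 ⟨by linarith, this.2⟩
  · exact (continuous_finsetSum _ fun h _ =>
      (continuous_channel_apply s h).mul continuous_const).continuousOn

/-- The channel `q` mixed with the uniform channel, of weight `η`. -/
noncomputable def mixUniform (η : ℝ) (q : S → H → ℝ) (s : S) (h : H) : ℝ :=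
  (1 - η) * q s h + η * (Fintype.card H : ℝ)⁻¹

theorem sum_card_inv [Nonempty H] : ∑ _h : H, (Fintype.card H : ℝ)⁻¹ = 1 := by
  rw [Finset.sum_const, Finset.card_univ, nsmul_eq_mul]
  exact mul_inv_cancel₀ (by exact_mod_cast Fintype.card_ne_zero)

theorem mixUniform_mem [Nonempty H] (hq : q ∈ channels S H) {η : ℝ} (h0 : 0 ≤ η) (h1 : η ≤ 1) :
    mixUniform η q ∈ channels S H := by
  refine fun s _ => ⟨fun h => ?_, ?_⟩
  · have := channel_nonneg hq s h
    have : 0 ≤ 1 - η := by linarith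
    unfold mixUniform
    positivity
  · simp only [mixUniform, Finset.sum_add_distrib, ← Finset.mul_sum, channel_sum hq, sum_card_inv]
    ring

theorem mixUniform_ge (hq : q ∈ channels S H) {η : ℝ} (h1 : η ≤ 1) (s : S) (h : H) :
    η * (Fintype.card H : ℝ)⁻¹ ≤ mixUniform η q s h :=
  le_add_of_nonneg_left (mul_nonneg (by linarith) (channel_nonneg hq s h))

theorem exists_mixUniform_lt [Nonempty H] (hq : q ∈ channels S H)
    (hδ : ∀ s h, 0 ≤ δ s h ∧ δ s h ≤ 1) {a b : ℝ} (ha : infoNats p q < a) (hb : cost p δ q < b) :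
    ∃ η, 0 < η ∧ η ≤ 1 ∧ infoNats p (mixUniform η q) < a ∧ cost p δ (mixUniform η q) < b := by
  have hc : Continuous fun η : ℝ => mixUniform η q := by
    refine continuous_pi fun s => continuous_pi fun h => ?_
    unfold mixUniform
    fun_prop
  have h0 : mixUniform 0 q = q := by
    funext s h
    simp [mixUniform]
  have hm : Set.MapsTo (fun η : ℝ => mixUniform η q) (Set.Icc 0 1) (channels S H) := fun η hη =>
    mixUniform_mem hq hη.1 hη.2
  have h01 : (0 : ℝ) ∈ Set.Icc (0 : ℝ) 1 := ⟨le_rfl, zero_le_one⟩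
  have e1 := ((continuousOn_infoNats (p := p)).comp hc.continuousOn hm 0 h01).eventually_lt_const
    (u := a) (by simpa [h0] using ha)
  have e2 := ((continuousOn_cost (p := p) hδ).comp hc.continuousOn hm 0 h01).eventually_lt_const
    (u := b) (by simpa [h0] using hb)
  have e3 := (e1.and e2).filter_mono (nhdsWithin_mono (0 : ℝ) Set.Ioc_subset_Icc_self)
  have hne : (nhdsWithin (0 : ℝ) (Set.Ioc 0 1)).NeBot := by
    rw [nhdsWithin_Ioc_eq_nhdsGT zero_lt_one]
    infer_instance
  obtain ⟨η, h, hη⟩ := (e3.and self_mem_nhdsWithin).exists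
  exact ⟨η, hη.1, hη.2, h.1, h.2⟩

/-! ### Strictly positive channels -/

theorem outLaw_ge (hq : q ∈ channels S H) {c : ℝ} (hc : ∀ s h, c ≤ q s h) (h : H) :
    c ≤ outLaw p q h :=
  (expect_mem_Icc (p := p) fun s => ⟨hc s h, channel_le_one hq s h⟩).1

theorem isBdd_log_ratio (hq : q ∈ channels S H) {c : ℝ} (h0 : 0 < c) (hc : ∀ s h, c ≤ q s h) :
    IsBdd fun x : S × H => Real.log (q x.1 x.2) - Real.log (outLaw p q x.2) := by
  refine .sub (.of_mem_Icc (a := Real.log c) (b := 0) fun x => ⟨?_, ?_⟩)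
    (.of_mem_Icc (a := Real.log c) (b := 0) fun x => ⟨?_, ?_⟩)
  · exact Real.log_le_log h0 (hc _ _)
  · exact Real.log_nonpos (channel_nonneg hq _ _) (channel_le_one hq _ _)
  · exact Real.log_le_log h0 (outLaw_ge hq hc _)
  · exact Real.log_nonpos (outLaw_mem_Icc hq _).1 (outLaw_mem_Icc hq _).2

theorem infoNats_nonneg (hq : q ∈ channels S H) {c : ℝ} (h0 : 0 < c) (hc : ∀ s h, c ≤ q s h) :
    0 ≤ infoNats p q := by
  have hb := isBdd_log_ratio (p := p) hq h0 hc
  have h1 : expect p (fun s => ∑ h, (q s h - outLaw p q h)) = 0 := by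
    simp only [Finset.sum_sub_distrib, channel_sum hq, sum_outLaw hq, sub_self, expect_const]
  rw [← h1]
  refine expect_mono (.sum fun h _ => (isBdd_channel hq h).sub (.const _))
    (.sum fun h _ => (isBdd_channel hq h).mul (hb.comp fun s => (s, h))) fun s _ => ?_
  refine Finset.sum_le_sum fun h _ => ?_
  have hq0 : 0 < q s h := h0.trans_le (hc s h)
  have ho : 0 < outLaw p q h := h0.trans_le (outLaw_ge hq hc h)
  have h2 := Real.log_le_sub_one_of_pos (div_pos ho hq0)
  rw [Real.log_div ho.ne' hq0.ne'] at h2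
  have h3 : q s h * (outLaw p q h / q s h) = outLaw p q h := by field_simp
  nlinarith

/-! ### Mutual information of a joint law -/

theorem mutualInfo_joint (Q : S → PMF H) :
    mutualInfo (joint p Q) = infoNats p (fun s h => (Q s h).toReal) / Real.log 2 := by
  classical
  set q : S → H → ℝ := fun s h => (Q s h).toReal with hqdef
  have hq : q ∈ channels S H := toReal_mem_channels Q
  have hout : ∀ h, ((joint p Q).map Prod.snd h).toReal = outLaw p q h := by
    intro h
    rw [joint, PMF.map_bind, PMF.bind_apply,
      ENNReal.tsum_toReal_eq fun a => ENNReal.mul_ne_top (p.apply_ne_top a) (PMF.apply_ne_top _ _)]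
    refine tsum_congr fun s => ?_
    rw [PMF.map_comp, ENNReal.toReal_mul]
    have : Prod.snd ∘ (fun b : H => (s, b)) = id := rfl
    rw [this, PMF.map_id]
  have hterm : ∀ x : S × H, (joint p Q x).toReal * Real.logb 2 ((joint p Q x).toReal /
      (((joint p Q).map Prod.fst x.1).toReal * ((joint p Q).map Prod.snd x.2).toReal)) =
      (p x.1).toReal * (q x.1 x.2 * (Real.log (q x.1 x.2) - Real.log (outLaw p q x.2)) /
        Real.log 2) := by
    rintro ⟨s, h⟩
    rw [hout, joint_apply, map_fst_joint, ENNReal.toReal_mul]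
    change (p s).toReal * q s h * Real.logb 2 ((p s).toReal * q s h / ((p s).toReal * _)) = _
    by_cases hs : (p s).toReal = 0
    · simp [hs]
    by_cases hh : q s h = 0
    · simp [hh]
    have ho : outLaw p q h ≠ 0 := by
      have h1 : (p s).toReal * q s h ≤ outLaw p q h :=
        (isBdd_channel hq h).summable.le_tsum s fun a _ =>
          mul_nonneg ENNReal.toReal_nonneg (channel_nonneg hq a h)
      have h2 : 0 < (p s).toReal * q s h := by
        have := (Ne.symm hs).lt_of_le ENNReal.toReal_nonneg
        have := (Ne.symm hh).lt_of_le (channel_nonneg hq s h)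
        positivity
      exact (h2.trans_le h1).ne'
    rw [mul_div_mul_left _ _ hs, Real.logb, Real.log_div hh ho]
    ring
  have hsum : Summable fun x : S × H => (p x.1).toReal *
      (q x.1 x.2 * (Real.log (q x.1 x.2) - Real.log (outLaw p q x.2)) / Real.log 2) := by
    have h1 : Summable fun x : S × H => (p x.1).toReal *
        ((1 + |Real.log (outLaw p q x.2)|) / |Real.log 2|) :=
      Summable.mul_of_nonneg (f := fun s => (p s).toReal)
        (g := fun h => (1 + |Real.log (outLaw p q h)|) / |Real.log 2|) (summable_toReal_pmf p)
        (hasSum_fintype _).summable (fun _ => ENNReal.toReal_nonneg) fun _ => by positivity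
    refine Summable.of_norm_bounded h1 fun x => ?_
    rw [norm_mul, Real.norm_eq_abs, Real.norm_eq_abs, abs_of_nonneg ENNReal.toReal_nonneg, abs_div,
      mul_sub]
    refine mul_le_mul_of_nonneg_left ?_ ENNReal.toReal_nonneg
    refine div_le_div_of_nonneg_right ((abs_sub _ _).trans (add_le_add ?_ ?_)) (abs_nonneg _)
    · exact abs_mul_log_le_one (channel_nonneg hq _ _) (channel_le_one hq _ _)
    · rw [abs_mul, abs_of_nonneg (channel_nonneg hq _ _)]
      exact mul_le_of_le_one_left (abs_nonneg _) (channel_le_one hq _ _)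
  rw [mutualInfo, tsum_congr hterm, hsum.tsum_prod, infoNats, expect, ← tsum_div_const]
  refine tsum_congr fun s => ?_
  rw [tsum_fintype, mul_div_assoc, Finset.sum_div, Finset.mul_sum]

end channels

/-! ### Random codebooks -/

section randomCoding

theorem sum_pi_prod {ι : Type u} {H : Type v} [Fintype ι] [DecidableEq ι] [Fintype H]
    (f : ι → H → ℝ) : ∑ x : ι → H, ∏ i, f i (x i) = ∏ i, ∑ h, f i h := by
  rw [Finset.prod_univ_sum, Fintype.piFinset_univ]

open Classical in
/-- A codebook of `M` independent codewords of law `v` leaves a source symbol `t` uncovered with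
probability `(1 - v(good t)) ^ M`; some codebook is at least as good as the average. -/
theorem exists_codebook {T : Type u} {W : Type v} [Fintype W] (ρ : PMF T) {v : W → ℝ}
    (hv : ∀ x, 0 < v x) (hv1 : ∑ x, v x = 1) (good : T → W → Prop) (M : ℕ) :
    ∃ F : Fin M → W, expect ρ (fun t => if ∃ j, good t (F j) then 0 else 1) ≤
      expect ρ fun t => (1 - ∑ x, v x * if good t x then 1 else 0) ^ M := by
  by_contra! hlt
  have hne : Nonempty W := by
    by_contra hW
    rw [not_nonempty_iff] at hW
    simp at hv1
  have hsum : ∑ F : Fin M → W, ∏ j, v (F j) = 1 := by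
    rw [sum_pi_prod fun (_ : Fin M) => v]
    simp [hv1]
  have hpt : ∀ t, ∑ F : Fin M → W, (∏ j, v (F j)) * (if ∃ j, good t (F j) then 0 else 1) =
      (1 - ∑ x, v x * if good t x then 1 else 0) ^ M := by
    intro t
    have h1 : (1 - ∑ x, v x * if good t x then 1 else 0) =
        ∑ x, v x * if good t x then 0 else 1 := by
      nth_rewrite 1 [← hv1]
      rw [← Finset.sum_sub_distrib]
      refine Finset.sum_congr rfl fun x _ => ?_
      split_ifs <;> simp
    have h2 := sum_pi_prod (ι := Fin M) fun _ x => v x * if good t x then 0 else 1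
    rw [Finset.prod_const, Finset.card_univ, Fintype.card_fin, ← h1] at h2
    rw [← h2]
    refine Finset.sum_congr rfl fun F _ => ?_
    rw [Finset.prod_mul_distrib]
    congr 1
    split_ifs with h
    · obtain ⟨j, hj⟩ := h
      symm
      exact Finset.prod_eq_zero (Finset.mem_univ j) (if_pos hj)
    · push Not at h
      exact (Finset.prod_eq_one fun j _ => if_neg (h j)).symm
  have hb : ∀ F : Fin M → W, IsBdd fun t => if ∃ j, good t (F j) then (0 : ℝ) else 1 := fun F =>
    .of_mem_Icc (a := 0) (b := 1) fun t => by split_ifs <;> norm_num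
  have hE : expect ρ (fun t => (1 - ∑ x, v x * if good t x then 1 else 0) ^ M) =
      ∑ F : Fin M → W, (∏ j, v (F j)) *
        expect ρ fun t => if ∃ j, good t (F j) then 0 else 1 := by
    simp only [← hpt, ← expect_const_mul]
    exact expect_sum fun F _ => (IsBdd.const _).mul (hb F)
  have hlt2 : ∑ F : Fin M → W, (∏ j, v (F j)) *
        expect ρ (fun t => (1 - ∑ x, v x * if good t x then 1 else 0) ^ M) <
      ∑ F : Fin M → W, (∏ j, v (F j)) *
        expect ρ fun t => if ∃ j, good t (F j) then 0 else 1 :=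
    Finset.sum_lt_sum_of_nonempty Finset.univ_nonempty fun F _ =>
      mul_lt_mul_of_pos_left (hlt F) (Finset.prod_pos fun j _ => hv _)
  rw [← Finset.sum_mul, hsum, one_mul, hE] at hlt2
  exact lt_irrefl _ hlt2

/-- If a codeword covers with probability at least `a / κ`, then all of `M` independent
codewords miss with probability at most `1 - a + exp (-M / κ)`. -/
theorem one_sub_pow_le {a π κ : ℝ} (ha0 : 0 ≤ a) (ha1 : a ≤ 1) (hπ : π ≤ 1) (hκ : 0 < κ)
    (h : a ≤ κ * π) (M : ℕ) : (1 - π) ^ M ≤ 1 - a + Real.exp (-(M / κ)) := by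
  have h1 : (1 - π) ^ M ≤ Real.exp (-(M / κ) * a) := by
    calc (1 - π) ^ M ≤ Real.exp (-π) ^ M :=
          pow_le_pow_left₀ (by linarith) (Real.one_sub_le_exp_neg π) M
      _ = Real.exp (-(M * π)) := by rw [← Real.exp_nat_mul]; ring_nf
      _ ≤ _ := by
        refine Real.exp_le_exp.2 ?_
        have h2 : a / κ ≤ π := (div_le_iff₀' hκ).2 h
        have h3 := mul_le_mul_of_nonneg_left h2 (Nat.cast_nonneg (α := ℝ) M)
        have h4 : -(M / κ) * a = -(M * (a / κ)) := by ring
        linarith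
  have h2 := convexOn_exp.2 (Set.mem_univ 0) (Set.mem_univ (-(M / κ))) (sub_nonneg.2 ha1) ha0
    (by ring)
  simp only [smul_eq_mul, mul_zero, zero_add, Real.exp_zero, mul_one] at h2
  have h3 := mul_le_of_le_one_left (Real.exp_pos (-(M / κ))).le ha1
  rw [mul_comm] at h1
  linarith

variable {S : Type u} {H : Type v} [Fintype H] {p : PMF S} {q δ : S → H → ℝ}

theorem isBdd_channel_sum (hq : q ∈ channels S H) {g : S → H → ℝ}
    (hg : IsBdd fun x : S × H => g x.1 x.2) : IsBdd fun s => ∑ h, q s h * g s h :=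
  .sum fun h _ => (isBdd_channel hq h).mul (hg.comp fun s => (s, h))

theorem cost_sub_const (hq : q ∈ channels S H) {g : S → H → ℝ}
    (hg : IsBdd fun x : S × H => g x.1 x.2) (c : ℝ) :
    cost p (fun s h => g s h - c) q = cost p g q - c := by
  simp only [cost, mul_sub, Finset.sum_sub_distrib, ← Finset.sum_mul, channel_sum hq, one_mul]
  rw [expect_sub (isBdd_channel_sum hq hg) (.const c), expect_const]

theorem isBdd_exp {α : Type u} {f : α → ℝ} (hf : IsBdd f) : IsBdd fun x => Real.exp (f x) := by
  obtain ⟨B, hB⟩ := hf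
  refine ⟨Real.exp B, fun x => ?_⟩
  rw [abs_of_pos (Real.exp_pos _)]
  exact Real.exp_le_exp.2 (abs_le.1 (hB x)).2

/-- The exponential moment behind the Chernoff bound: a bounded variable of negative mean has
a moment generating function below `1` somewhere on the positive axis. -/
theorem exists_cost_exp_lt_one (hq : q ∈ channels S H) {g : S → H → ℝ}
    (hg : IsBdd fun x : S × H => g x.1 x.2) (hneg : cost p g q < 0) :
    ∃ t : ℝ, 0 < t ∧ cost p (fun s h => Real.exp (t * g s h)) q < 1 := by
  obtain ⟨B₀, hB₀⟩ := id hg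
  set B := max B₀ 1 with hBdef
  have hB1 : 1 ≤ B := le_max_right _ _
  have hB : ∀ s h, |g s h| ≤ B := fun s h => (hB₀ (s, h)).trans (le_max_left _ _)
  set μ := cost p g q with hμ
  set t := min (1 / B) (-μ / (2 * B ^ 2)) with ht
  have hB0 : 0 < B := by linarith
  have ht0 : 0 < t := lt_min (by positivity) (div_pos (by linarith) (by positivity))
  have htB : t * B ≤ 1 := by
    have := min_le_left (1 / B) (-μ / (2 * B ^ 2))
    rwa [← ht, le_div_iff₀ hB0] at this
  have htB2 : t * (2 * B ^ 2) ≤ -μ := by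
    have := min_le_right (1 / B) (-μ / (2 * B ^ 2))
    rwa [← ht, le_div_iff₀ (by positivity)] at this
  refine ⟨t, ht0, ?_⟩
  have hpt : ∀ s h, Real.exp (t * g s h) ≤ 1 + t ^ 2 * B ^ 2 + t * g s h := by
    intro s h
    have h1 : |t * g s h| ≤ t * B := by
      rw [abs_mul, abs_of_pos ht0]
      exact mul_le_mul_of_nonneg_left (hB s h) ht0.le
    have h2 := (abs_le.1 (Real.abs_exp_sub_one_sub_id_le (h1.trans htB))).2
    have h3 : (t * g s h) ^ 2 ≤ (t * B) ^ 2 := sq_le_sq' (abs_le.1 h1).1 (abs_le.1 h1).2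
    nlinarith
  calc cost p (fun s h => Real.exp (t * g s h)) q
      ≤ expect p fun s => (1 + t ^ 2 * B ^ 2) + t * ∑ h, q s h * g s h := by
        refine expect_mono (isBdd_channel_sum hq (isBdd_exp ((IsBdd.const t).mul hg)))
          ((IsBdd.const _).add ((IsBdd.const _).mul (isBdd_channel_sum hq hg))) fun s _ => ?_
        calc _ ≤ ∑ h, q s h * (1 + t ^ 2 * B ^ 2 + t * g s h) :=
              Finset.sum_le_sum fun h _ =>
                mul_le_mul_of_nonneg_left (hpt s h) (channel_nonneg hq s h)
          _ = _ := by
            simp only [mul_add (q s _) (1 + t ^ 2 * B ^ 2), Finset.sum_add_distrib,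
              ← Finset.sum_mul, channel_sum hq, one_mul, mul_left_comm _ t, ← Finset.mul_sum]
    _ = 1 + t ^ 2 * B ^ 2 + t * μ := by
        rw [expect_add (.const _) ((IsBdd.const _).mul (isBdd_channel_sum hq hg)), expect_const,
          expect_const_mul]
        rfl
    _ < 1 := by nlinarith

theorem sum_pi_channel (hq : q ∈ channels S H) {n : ℕ} (s : Fin n → S) :
    ∑ x : Fin n → H, ∏ i, q (s i) (x i) = 1 := by
  rw [sum_pi_prod fun i h => q (s i) h]
  simp [channel_sum hq]

/-- The codeword `x` covers the source word `s`: along the two words the information density of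
the channel `q` has sum at most `n c₁`, and `g` has sum at most `0`. -/
def Covers (p : PMF S) (q g : S → H → ℝ) (c₁ : ℝ) {n : ℕ} (s : Fin n → S) (x : Fin n → H) : Prop :=
  ∑ i, (Real.log (q (s i) (x i)) - Real.log (outLaw p q (x i)) - c₁) ≤ 0 ∧
    ∑ i, g (s i) (x i) ≤ 0

open Classical in
/-- The Chernoff bound for a memoryless channel, given the input word: the output word does
not cover it with a probability which is at most the sum of two products. -/
theorem one_sub_sum_covers_le (hq : q ∈ channels S H) {g : S → H → ℝ} {c₁ t₁ t₂ : ℝ} (h₁ : 0 < t₁)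
    (h₂ : 0 < t₂) {n : ℕ} (s : Fin n → S) :
    1 - ∑ x : Fin n → H, (∏ i, q (s i) (x i)) * (if Covers p q g c₁ s x then 1 else 0) ≤
      (∏ i, ∑ h, q (s i) h *
        Real.exp (t₁ * (Real.log (q (s i) h) - Real.log (outLaw p q h) - c₁))) +
        ∏ i, ∑ h, q (s i) h * Real.exp (t₂ * g (s i) h) := by
  nth_rewrite 1 [← sum_pi_channel hq s]
  rw [← Finset.sum_sub_distrib, ← sum_pi_prod, ← sum_pi_prod, ← Finset.sum_add_distrib]
  refine Finset.sum_le_sum fun x _ => ?_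
  rw [Finset.prod_mul_distrib, Finset.prod_mul_distrib, ← Real.exp_sum, ← Real.exp_sum,
    ← Finset.mul_sum, ← Finset.mul_sum]
  have h0 : 0 ≤ ∏ i, q (s i) (x i) := Finset.prod_nonneg fun i _ => channel_nonneg hq _ _
  have e1 := mul_nonneg h0 (Real.exp_pos (t₁ *
    ∑ i, (Real.log (q (s i) (x i)) - Real.log (outLaw p q (x i)) - c₁))).le
  have e2 := mul_nonneg h0 (Real.exp_pos (t₂ * ∑ i, g (s i) (x i))).le
  split_ifs with hcov
  · linarith
  · rw [Covers, not_and_or, not_le, not_le] at hcov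
    rcases hcov with hg | hg
    · have := mul_le_mul_of_nonneg_left (Real.one_le_exp (mul_pos h₁ hg).le) h0
      linarith
    · have := mul_le_mul_of_nonneg_left (Real.one_le_exp (mul_pos h₂ hg).le) h0
      linarith

open Classical in
/-- The codebook whose codewords are drawn from the output law of the channel `q` covers all
but a small fraction of the source words. -/
theorem expect_not_covered_le (hq : q ∈ channels S H) {c : ℝ} (h0 : 0 < c) (hc : ∀ s h, c ≤ q s h)
    {g : S → H → ℝ} (hg : IsBdd fun x : S × H => g x.1 x.2) {t₁ t₂ c₁ R : ℝ} (h₁ : 0 < t₁)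
    (h₂ : 0 < t₂) (hc₁ : 0 ≤ c₁) {n M : ℕ} (hM : Real.exp (n * R) ≤ M + 1) :
    ∃ F : Fin M → Fin n → H, expect (iid p n) (fun s => if ∃ j,
        Covers p q g c₁ s (F j) then 0 else 1) ≤
      cost p (fun s h => Real.exp (t₁ * (Real.log (q s h) - Real.log (outLaw p q h) - c₁))) q ^ n +
      cost p (fun s h => Real.exp (t₂ * g s h)) q ^ n + Real.exp (-(R - c₁)) ^ n := by
  have hr0 : ∀ h, 0 < outLaw p q h := fun h => h0.trans_le (outLaw_ge hq hc h)
  have hv1 : ∑ x : Fin n → H, ∏ i, outLaw p q (x i) = 1 := by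
    rw [sum_pi_prod fun (_ : Fin n) => outLaw p q]
    simp [sum_outLaw hq]
  obtain ⟨F, hF⟩ := exists_codebook (iid p n) (v := fun x : Fin n → H => ∏ i, outLaw p q (x i))
    (fun x => Finset.prod_pos fun i _ => hr0 _) hv1 (Covers p q g c₁) M
  refine ⟨F, hF.trans ?_⟩
  set G₁ : S → ℝ := fun s =>
    ∑ h, q s h * Real.exp (t₁ * (Real.log (q s h) - Real.log (outLaw p q h) - c₁)) with hG₁
  set G₂ : S → ℝ := fun s => ∑ h, q s h * Real.exp (t₂ * g s h) with hG₂
  have hbG₁ : IsBdd G₁ := isBdd_channel_sum hq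
    (isBdd_exp ((IsBdd.const t₁).mul ((isBdd_log_ratio hq h0 hc).sub (.const c₁))))
  have hbG₂ : IsBdd G₂ := isBdd_channel_sum hq (isBdd_exp ((IsBdd.const t₂).mul hg))
  have hbP : ∀ {G : S → ℝ}, IsBdd G → IsBdd fun s : Fin n → S => ∏ i, G (s i) := fun hG =>
    .prod fun i _ => hG.comp fun s : Fin n → S => s i
  have hE : ∀ {G : S → ℝ}, IsBdd G →
      expect (iid p n) (fun s => ∏ i, G (s i)) = expect p G ^ n := fun {G} hG => by
    rw [expect_iid_prod fun _ => hG]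
    simp
  have hMR : Real.exp (-(M / Real.exp (n * c₁))) ≤ Real.exp (-(R - c₁)) ^ n := by
    rw [← Real.exp_nat_mul, Real.exp_le_exp]
    have h1 : Real.exp (n * R) / Real.exp (n * c₁) ≤ (M + 1) / Real.exp (n * c₁) := by gcongr
    rw [← Real.exp_sub, add_div] at h1
    have h2 : 1 / Real.exp (n * c₁) ≤ 1 :=
      (div_le_one (Real.exp_pos _)).2 (Real.one_le_exp (by positivity))
    have h3 := Real.add_one_le_exp ((n : ℝ) * R - n * c₁)
    linarith
  -- The probability that one codeword, and that all codewords, miss a given source word.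
  have hpt : ∀ s : Fin n → S,
      0 ≤ 1 - (∑ x : Fin n → H, (∏ i, outLaw p q (x i)) * if Covers p q g c₁ s x then 1 else 0) ∧
      1 - (∑ x : Fin n → H, (∏ i, outLaw p q (x i)) * if Covers p q g c₁ s x then 1 else 0) ≤ 1 ∧
      (1 - ∑ x : Fin n → H, (∏ i, outLaw p q (x i)) * if Covers p q g c₁ s x then 1 else 0) ^ M ≤
        (∏ i, G₁ (s i)) + (∏ i, G₂ (s i)) + Real.exp (-(R - c₁)) ^ n := by
    intro s
    have hπ1 : (∑ x : Fin n → H, (∏ i, outLaw p q (x i)) * if Covers p q g c₁ s x then 1 else 0) ≤ 1 := by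
      refine le_of_le_of_eq (Finset.sum_le_sum fun x _ => ?_) hv1
      refine mul_le_of_le_one_right (Finset.prod_nonneg fun i _ => (hr0 _).le) ?_
      split_ifs <;> norm_num
    have hπ0 : 0 ≤ ∑ x : Fin n → H, (∏ i, outLaw p q (x i)) * if Covers p q g c₁ s x then (1 : ℝ) else 0 :=
      Finset.sum_nonneg fun x _ => mul_nonneg (Finset.prod_nonneg fun i _ => (hr0 _).le)
        (by split_ifs <;> norm_num)
    refine ⟨by linarith, by linarith, ?_⟩
    set a := ∑ x : Fin n → H, (∏ i, q (s i) (x i)) * (if Covers p q g c₁ s x then (1 : ℝ) else 0) with ha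
    have ha0 : 0 ≤ a := Finset.sum_nonneg fun x _ =>
      mul_nonneg (Finset.prod_nonneg fun i _ => channel_nonneg hq _ _) (by split_ifs <;> norm_num)
    have ha1 : a ≤ 1 := by
      rw [← sum_pi_channel hq s]
      refine Finset.sum_le_sum fun x _ => ?_
      refine mul_le_of_le_one_right (Finset.prod_nonneg fun i _ => channel_nonneg hq _ _) ?_
      split_ifs <;> norm_num
    have hκ : a ≤ Real.exp (n * c₁) *
        ∑ x : Fin n → H, (∏ i, outLaw p q (x i)) * if Covers p q g c₁ s x then 1 else 0 := by
      rw [Finset.mul_sum]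
      refine Finset.sum_le_sum fun x _ => ?_
      split_ifs with hx
      · -- On the good set the density of the channel with respect to its output law is small.
        have h1 : ∏ i, q (s i) (x i) = Real.exp (∑ i, Real.log (q (s i) (x i))) := by
          rw [Real.exp_sum]
          exact Finset.prod_congr rfl fun i _ => (Real.exp_log (h0.trans_le (hc _ _))).symm
        have h2 : ∏ i, outLaw p q (x i) = Real.exp (∑ i, Real.log (outLaw p q (x i))) := by
          rw [Real.exp_sum]
          exact Finset.prod_congr rfl fun i _ => (Real.exp_log (hr0 _)).symm
        rw [h1, h2, mul_one, mul_one, ← Real.exp_add, Real.exp_le_exp]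
        have h3 := hx.1
        simp only [Finset.sum_sub_distrib, Finset.sum_const, Finset.card_univ, Fintype.card_fin,
          nsmul_eq_mul] at h3
        linarith
      · simp
    have h1 := one_sub_pow_le ha0 ha1 hπ1 (Real.exp_pos _) hκ M
    have h2 := one_sub_sum_covers_le (p := p) hq (g := g) (c₁ := c₁) h₁ h₂ s
    change 1 - a ≤ (∏ i, G₁ (s i)) + ∏ i, G₂ (s i) at h2
    linarith
  calc expect (iid p n) (fun s =>
        (1 - ∑ x : Fin n → H, (∏ i, outLaw p q (x i)) * if Covers p q g c₁ s x then 1 else 0) ^ M)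
      ≤ expect (iid p n) fun s =>
        (∏ i, G₁ (s i)) + (∏ i, G₂ (s i)) + Real.exp (-(R - c₁)) ^ n := by
        refine expect_mono (.of_mem_Icc (a := 0) (b := 1) fun s => ⟨?_, ?_⟩)
          (((hbP hbG₁).add (hbP hbG₂)).add (.const _)) fun s _ => (hpt s).2.2
        · exact pow_nonneg (hpt s).1 M
        · exact pow_le_one₀ (hpt s).1 (hpt s).2.1
    _ = expect p G₁ ^ n + expect p G₂ ^ n + Real.exp (-(R - c₁)) ^ n := by
        rw [expect_add ((hbP hbG₁).add (hbP hbG₂)) (.const _), expect_add (hbP hbG₁) (hbP hbG₂),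
          hE hbG₁, hE hbG₂, expect_const]

theorem tendsto_pow_add_pow_add_pow {a b c : ℝ} (ha0 : 0 ≤ a) (ha : a < 1) (hb0 : 0 ≤ b)
    (hb : b < 1) (hc0 : 0 ≤ c) (hc : c < 1) :
    Filter.Tendsto (fun n : ℕ => a ^ n + b ^ n + c ^ n) Filter.atTop (nhds 0) := by
  simpa using ((tendsto_pow_atTop_nhds_zero_of_lt_one ha0 ha).add
    (tendsto_pow_atTop_nhds_zero_of_lt_one hb0 hb)).add
    (tendsto_pow_atTop_nhds_zero_of_lt_one hc0 hc)

/-- Achievability for a strictly positive channel: above its information, long codes attain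
any cost larger than the cost of the channel. -/
theorem eventually_exists_code_of_pos (hq : q ∈ channels S H) {c : ℝ} (h0 : 0 < c)
    (hc : ∀ s h, c ≤ q s h) (hδ : ∀ s h, 0 ≤ δ s h ∧ δ s h ≤ 1) {R T : ℝ} (hR : infoNats p q < R)
    (hT : cost p δ q < T) :
    ∀ᶠ n : ℕ in Filter.atTop, ∀ M : ℕ, Real.exp (n * R) ≤ M + 1 →
      ∃ (enc : (Fin n → S) → Fin M) (dec : Fin M → Fin n → H),
        expect (iid p n) (fun s => ∑ i, δ (s i) (dec (enc s) i)) ≤ n * T := by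
  classical
  obtain ⟨c₁, hIc, hcR⟩ := exists_between hR
  obtain ⟨c₂, hdc, hcT⟩ := exists_between hT
  have hc₁ : 0 ≤ c₁ := (infoNats_nonneg hq h0 hc).trans hIc.le
  have hbδ : IsBdd fun x : S × H => δ x.1 x.2 := .of_mem_Icc fun x => hδ _ _
  have hb₁ := isBdd_log_ratio (p := p) hq h0 hc
  obtain ⟨t₁, ht₁, hρ₁⟩ := exists_cost_exp_lt_one (p := p) hq
    (g := fun s h => Real.log (q s h) - Real.log (outLaw p q h) - c₁) (hb₁.sub (.const c₁)) (by
      rw [cost_sub_const hq hb₁]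
      exact sub_neg.2 hIc)
  obtain ⟨t₂, ht₂, hρ₂⟩ := exists_cost_exp_lt_one (p := p) hq (g := fun s h => δ s h - c₂)
    (hbδ.sub (.const c₂)) (by
      rw [cost_sub_const hq hbδ]
      exact sub_neg.2 hdc)
  have hcost0 : ∀ f : S → H → ℝ, 0 ≤ cost p (fun s h => Real.exp (f s h)) q := fun f =>
    expect_nonneg fun s => Finset.sum_nonneg fun h _ =>
      mul_nonneg (channel_nonneg hq s h) (Real.exp_pos _).le
  have hlim := tendsto_pow_add_pow_add_pow (hcost0 _) hρ₁ (hcost0 _) hρ₂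
    (Real.exp_pos (-(R - c₁))).le (Real.exp_lt_one_iff.2 (by linarith))
  filter_upwards [hlim.eventually_le_const (sub_pos.2 hcT), Filter.eventually_ge_atTop 1]
    with n hn hn1 M hM
  obtain ⟨F, hF⟩ := expect_not_covered_le (p := p) hq h0 hc (g := fun s h => δ s h - c₂) (hbδ.sub (.const c₂)) ht₁ ht₂ hc₁ hM
  have hMpos : 0 < M := by
    have h1 : (1 : ℝ) ≤ n := by exact_mod_cast hn1
    have h2 : 0 < (n : ℝ) * R := by
      have : 0 < R := hc₁.trans_lt hcR
      positivity
    have h3 : (0 : ℝ) < M := by linarith [Real.add_one_le_exp ((n : ℝ) * R)]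
    exact_mod_cast h3
  set cov : (Fin n → S) → Fin M → Prop := fun s j => Covers p q (fun s h => δ s h - c₂) c₁ s (F j)
    with hcov
  have hbad : ∀ s, ∃ j, (∃ j, cov s j) → cov s j := fun s => by
    by_cases h : ∃ j, cov s j
    · exact h.imp fun j hj _ => hj
    · exact ⟨⟨0, hMpos⟩, fun h' => absurd h' h⟩
  choose enc henc using hbad
  refine ⟨enc, F, ?_⟩
  have hsum : ∀ (s : Fin n → S) (x : Fin n → H),
      0 ≤ ∑ i, δ (s i) (x i) ∧ ∑ i, δ (s i) (x i) ≤ n := fun s x =>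
    ⟨Finset.sum_nonneg fun i _ => (hδ _ _).1, by
      simpa using Finset.sum_le_card_nsmul Finset.univ _ 1 fun i _ => (hδ (s i) (x i)).2⟩
  have hc₂ : 0 ≤ c₂ := hdc.le.trans' (expect_nonneg fun s => Finset.sum_nonneg fun h _ =>
    mul_nonneg (channel_nonneg hq s h) (hδ s h).1)
  have hbf : IsBdd fun s : Fin n → S => if ∃ j, cov s j then (0 : ℝ) else 1 :=
    .of_mem_Icc (a := 0) (b := 1) fun s => by split_ifs <;> norm_num
  calc _ ≤ expect (iid p n) fun s => n * c₂ + n * if ∃ j, cov s j then 0 else 1 := by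
        refine expect_mono (.of_mem_Icc fun s => hsum s _)
          ((IsBdd.const _).add ((IsBdd.const _).mul hbf)) fun s _ => ?_
        split_ifs with h
        · have h1 := (henc s h).2
          simp only [Finset.sum_sub_distrib, Finset.sum_const, Finset.card_univ, Fintype.card_fin,
            nsmul_eq_mul] at h1
          linarith
        · have h1 := (hsum s (F (enc s))).2
          have h2 : 0 ≤ (n : ℝ) * c₂ := by positivity
          linarith
    _ = n * (c₂ + expect (iid p n) fun s => if ∃ j, cov s j then 0 else 1) := by
        rw [expect_add (.const _) ((IsBdd.const _).mul hbf), expect_const, expect_const_mul]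
        ring
    _ ≤ n * T := mul_le_mul_of_nonneg_left (by linarith) (Nat.cast_nonneg n)

/-- Achievability for an arbitrary channel, which is approximated by strictly positive ones. -/
theorem eventually_exists_code [Nonempty H] (hq : q ∈ channels S H)
    (hδ : ∀ s h, 0 ≤ δ s h ∧ δ s h ≤ 1) {R T : ℝ} (hR : infoNats p q < R) (hT : cost p δ q < T) :
    0 < R ∧ ∀ᶠ n : ℕ in Filter.atTop, ∀ M : ℕ, Real.exp (n * R) ≤ M + 1 →
      ∃ (enc : (Fin n → S) → Fin M) (dec : Fin M → Fin n → H),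
        expect (iid p n) (fun s => ∑ i, δ (s i) (dec (enc s) i)) ≤ n * T := by
  obtain ⟨η, h0, h1, hI, hd⟩ := exists_mixUniform_lt hq hδ hR hT
  have hm := mixUniform_mem hq h0.le h1
  have hc : 0 < η * (Fintype.card H : ℝ)⁻¹ := by positivity
  exact ⟨(infoNats_nonneg hm hc (mixUniform_ge hq h1)).trans_lt hI,
    eventually_exists_code_of_pos hm hc (mixUniform_ge hq h1) hδ hI hd⟩

end randomCoding

/-! ### The converse for a single code -/

section converse

variable {S : Type u} {H : Type v} [Fintype H] {p : PMF S} {q δ : S → H → ℝ}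

theorem cost_mixUniform (hq : q ∈ channels S H) {g : S → H → ℝ}
    (hg : IsBdd fun x : S × H => g x.1 x.2) (η : ℝ) :
    cost p g (mixUniform η q) = (1 - η) * cost p g q +
      η * ((Fintype.card H : ℝ)⁻¹ * expect p fun s => ∑ h, g s h) := by
  have hs : IsBdd fun s => ∑ h, g s h := .sum fun h _ => hg.comp fun s => (s, h)
  simp only [cost, ← expect_const_mul]
  rw [← expect_add ((IsBdd.const _).mul (isBdd_channel_sum hq hg))
    ((IsBdd.const _).mul ((IsBdd.const _).mul hs))]
  simp only [mixUniform, add_mul, Finset.sum_add_distrib, Finset.mul_sum, mul_assoc]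

theorem cost_mixUniform_le [Nonempty H] (hq : q ∈ channels S H)
    (hδ : ∀ s h, 0 ≤ δ s h ∧ δ s h ≤ 1) {η : ℝ} (h0 : 0 ≤ η) :
    cost p δ (mixUniform η q) ≤ cost p δ q + η := by
  rw [cost_mixUniform hq (.of_mem_Icc fun x => hδ x.1 x.2)]
  have h1 : 0 ≤ cost p δ q := expect_nonneg fun s => (channel_sum_mul_mem_Icc hq (hδ s)).1
  have h2 : expect p (fun s => ∑ h, δ s h) ≤ Fintype.card H :=
    (expect_mem_Icc (c := 0) fun s => ⟨Finset.sum_nonneg fun h _ => (hδ s h).1, by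
      simpa using Finset.sum_le_card_nsmul Finset.univ _ 1 fun h _ => (hδ s h).2⟩).2
  have h3 : (Fintype.card H : ℝ)⁻¹ * expect p (fun s => ∑ h, δ s h) ≤ 1 := by
    have hc : (0 : ℝ) < Fintype.card H := by exact_mod_cast Fintype.card_pos
    rwa [inv_mul_le_iff₀ hc, mul_one]
  nlinarith

/-- The channel obtained by using one of the channels `Q i`, chosen at random. -/
noncomputable def avgChannel {n : ℕ} (Q : Fin n → S → H → ℝ) (s : S) (h : H) : ℝ :=
  (n : ℝ)⁻¹ * ∑ i, Q i s h

theorem avgChannel_mem {n : ℕ} (hn : n ≠ 0) {Q : Fin n → S → H → ℝ}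
    (hQ : ∀ i, Q i ∈ channels S H) : avgChannel Q ∈ channels S H := by
  refine fun s _ => ⟨fun h => ?_, ?_⟩
  · exact mul_nonneg (by positivity) (Finset.sum_nonneg fun i _ => channel_nonneg (hQ i) s h)
  · simp only [avgChannel, ← Finset.mul_sum]
    rw [Finset.sum_comm]
    simp [channel_sum (hQ _), hn]

theorem cost_avgChannel {n : ℕ} {Q : Fin n → S → H → ℝ} (hQ : ∀ i, Q i ∈ channels S H)
    {g : S → H → ℝ} (hg : IsBdd fun x : S × H => g x.1 x.2) :
    cost p g (avgChannel Q) = (n : ℝ)⁻¹ * ∑ i, cost p g (Q i) := by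
  simp only [cost, avgChannel]
  rw [← expect_sum fun i _ => isBdd_channel_sum (hQ i) hg, ← expect_const_mul]
  congr 1
  funext s
  rw [Finset.sum_comm, Finset.mul_sum]
  refine Finset.sum_congr rfl fun h _ => ?_
  rw [mul_assoc, Finset.sum_mul]

theorem expect_ratio_outLaw {ι : Type w} {q : S → ι → ℝ} {h : ι} (hpos : 0 < outLaw p q h) :
    expect p (fun s => q s h / outLaw p q h) = 1 := by
  simp only [div_eq_inv_mul, expect_const_mul]
  exact inv_mul_cancel₀ hpos.ne'

/-- The converse for one code: if `M` codewords induce on average the channel `q`, then the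
information of the perturbed channel `w` satisfies `n I ≤ log M`.  The product of the densities
`w(h | s) / w(h)` along the source word and its reconstruction is at most the sum of these
products over all codewords, and so has mean at most `M`; its logarithm has mean at most
`log M`. -/
theorem mul_infoNats_le_log [Nonempty H] (hq : q ∈ channels S H) {n M : ℕ} (hn : n ≠ 0)
    (enc : (Fin n → S) → Fin M) (dec : Fin M → Fin n → H)
    (hcode : ∀ g : S → H → ℝ, (IsBdd fun x : S × H => g x.1 x.2) →
      cost p g q = (n : ℝ)⁻¹ * expect (iid p n) fun s => ∑ i, g (s i) (dec (enc s) i))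
    {η : ℝ} (h0 : 0 < η) (h1 : η ≤ 1) :
    n * infoNats p (mixUniform η q) ≤ Real.log M := by
  set w := mixUniform η q with hw
  have hwm : w ∈ channels S H := mixUniform_mem hq h0.le h1
  set c := η * (Fintype.card H : ℝ)⁻¹ with hcdef
  have hc0 : 0 < c := by positivity
  have hc : ∀ s h, c ≤ w s h := mixUniform_ge hq h1
  have hr0 : ∀ h, 0 < outLaw p w h := fun h => hc0.trans_le (outLaw_ge hwm hc h)
  have hw0 : ∀ s h, 0 < w s h := fun s h => hc0.trans_le (hc s h)
  set g : S → H → ℝ := fun s h => Real.log (w s h) - Real.log (outLaw p w h) with hgdef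
  have hg : IsBdd fun x : S × H => g x.1 x.2 := isBdd_log_ratio hwm hc0 hc
  have hratio : ∀ h, IsBdd fun s => w s h / outLaw p w h := fun h => by
    simp only [div_eq_mul_inv]
    exact (isBdd_channel hwm h).mul (.const _)
  have hglog : ∀ s h, g s h = Real.log (w s h / outLaw p w h) := fun s h =>
    (Real.log_div (hw0 s h).ne' (hr0 h).ne').symm
  -- The uniform part of the mixture contributes a nonpositive amount.
  have hunif : expect p (fun s => ∑ h, g s h) ≤ 0 := by
    calc expect p (fun s => ∑ h, g s h)
        ≤ expect p fun s => ∑ h, (w s h / outLaw p w h - 1) := by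
          refine expect_mono (.sum fun h _ => hg.comp fun s => (s, h))
            (.sum fun h _ => (hratio h).sub (.const 1)) fun s _ => Finset.sum_le_sum fun h _ => ?_
          rw [hglog]
          exact Real.log_le_sub_one_of_pos (div_pos (hw0 s h) (hr0 h))
      _ = 0 := by
          rw [expect_sum fun h _ => (hratio h).sub (.const 1)]
          refine Finset.sum_eq_zero fun h _ => ?_
          rw [expect_sub (hratio h) (.const 1), expect_ratio_outLaw (hr0 h), expect_const,
            sub_self]
  have : Nonempty S := p.support_nonempty.to_type
  have hM : 1 ≤ M := by
    have := (enc fun _ => Classical.arbitrary S).pos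
    omega
  have hM0 : (0 : ℝ) < M := by exact_mod_cast hM
  have hlogM : 0 ≤ Real.log M := Real.log_natCast_nonneg M
  set X : (Fin n → S) → Fin M → ℝ := fun s j => ∏ i, w (s i) (dec j i) / outLaw p w (dec j i)
    with hX
  have hXpos : ∀ s j, 0 < X s j := fun s j => Finset.prod_pos fun i _ => div_pos (hw0 _ _) (hr0 _)
  have hXb : ∀ j, IsBdd fun s => X s j := fun j =>
    .prod fun i _ => (hratio (dec j i)).comp fun s : Fin n → S => s i
  have hXE : ∀ j, expect (iid p n) (fun s => X s j) = 1 := fun j => by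
    rw [expect_iid_prod fun i => hratio (dec j i)]
    exact Finset.prod_eq_one fun i _ => expect_ratio_outLaw (hr0 _)
  have hsumg : IsBdd fun s : Fin n → S => ∑ i, g (s i) (dec (enc s) i) :=
    .sum fun i _ => hg.comp fun s : Fin n → S => (s i, dec (enc s) i)
  have hcodelog : expect (iid p n) (fun s => ∑ i, g (s i) (dec (enc s) i)) ≤ Real.log M := by
    calc expect (iid p n) (fun s => ∑ i, g (s i) (dec (enc s) i))
        ≤ expect (iid p n) fun s => (M : ℝ)⁻¹ * ∑ j, X s j + (Real.log M - 1) := by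
          refine expect_mono hsumg
            (((IsBdd.const _).mul (.sum fun j _ => hXb j)).add (.const _)) fun s _ => ?_
          have e1 : ∑ i, g (s i) (dec (enc s) i) = Real.log (X s (enc s)) := by
            rw [hX, Real.log_prod fun i _ => (div_pos (hw0 _ _) (hr0 _)).ne']
            exact Finset.sum_congr rfl fun i _ => hglog _ _
          have e2 : X s (enc s) ≤ ∑ j, X s j :=
            Finset.single_le_sum (fun j _ => (hXpos s j).le) (Finset.mem_univ (enc s))
          have e3 := Real.log_le_sub_one_of_pos (div_pos (hXpos s (enc s)) hM0)
          rw [Real.log_div (hXpos s _).ne' hM0.ne', div_eq_inv_mul] at e3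
          have e4 := mul_le_mul_of_nonneg_left e2 (inv_nonneg.2 hM0.le)
          linarith
      _ = Real.log M := by
          rw [expect_add ((IsBdd.const _).mul (.sum fun j _ => hXb j)) (.const _), expect_const,
            expect_const_mul, expect_sum fun j _ => hXb j]
          simp only [hXE, Finset.sum_const, Finset.card_univ, Fintype.card_fin, nsmul_eq_mul,
            mul_one]
          rw [inv_mul_cancel₀ hM0.ne']
          ring
  have hinfo : infoNats p w = (1 - η) * cost p g q +
      η * ((Fintype.card H : ℝ)⁻¹ * expect p fun s => ∑ h, g s h) :=
    cost_mixUniform hq hg η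
  have hn0 : (0 : ℝ) < n := by exact_mod_cast Nat.pos_of_ne_zero hn
  have h2 : n * cost p g q ≤ Real.log M := by
    rw [hcode g hg, mul_inv_cancel_left₀ hn0.ne']
    exact hcodelog
  have h3 : (n : ℝ) * (η * ((Fintype.card H : ℝ)⁻¹ * expect p fun s => ∑ h, g s h)) ≤ 0 :=
    mul_nonpos_of_nonneg_of_nonpos hn0.le (mul_nonpos_of_nonneg_of_nonpos h0.le
      (mul_nonpos_of_nonneg_of_nonpos (by positivity) hunif))
  rw [hinfo]
  nlinarith

/-! ### Minimization over the channels -/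

/-- Compactness of the set of channels: constraints on information and cost which can be met up
to any positive error can be met exactly. -/
theorem exists_channel_of_approx (hδ : ∀ s h, 0 ≤ δ s h ∧ δ s h ≤ 1) {a b : ℝ}
    (happ : ∀ γ > 0, ∃ q ∈ channels S H, infoNats p q ≤ a + γ ∧ cost p δ q ≤ b + γ) :
    ∃ q ∈ channels S H, infoNats p q ≤ a ∧ cost p δ q ≤ b := by
  have hc : ContinuousOn (fun q => max (infoNats p q - a) (cost p δ q - b)) (channels S H) :=
    continuous_max.comp_continuousOn ((continuousOn_infoNats.sub continuousOn_const).prodMk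
      ((continuousOn_cost hδ).sub continuousOn_const))
  obtain ⟨q₁, hq₁, -⟩ := happ 1 one_pos
  obtain ⟨q₀, hq₀, hmin⟩ := isCompact_channels.exists_isMinOn ⟨q₁, hq₁⟩ hc
  have hle : max (infoNats p q₀ - a) (cost p δ q₀ - b) ≤ 0 := by
    by_contra! hpos
    obtain ⟨q, hq, hI, hd⟩ := happ _ (half_pos hpos)
    have h1 := hmin hq
    have h2 : max (infoNats p q - a) (cost p δ q - b) ≤
        max (infoNats p q₀ - a) (cost p δ q₀ - b) / 2 := max_le (by linarith) (by linarith)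
    have h3 := h1.trans h2
    linarith
  rw [max_le_iff] at hle
  exact ⟨q₀, hq₀, by linarith, by linarith⟩

theorem exists_isMinOn_infoNats (hδ : ∀ s h, 0 ≤ δ s h ∧ δ s h ≤ 1) {b : ℝ}
    (hne : ∃ q ∈ channels S H, cost p δ q ≤ b) :
    ∃ q ∈ channels S H, cost p δ q ≤ b ∧
      ∀ q' ∈ channels S H, cost p δ q' ≤ b → infoNats p q ≤ infoNats p q' := by
  set a := sInf (infoNats p '' {q ∈ channels S H | cost p δ q ≤ b}) with ha
  have hbdd : BddBelow (infoNats p '' {q ∈ channels S H | cost p δ q ≤ b}) :=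
    (isCompact_channels.bddBelow_image (continuousOn_infoNats (p := p))).mono
      (Set.image_mono fun q hq => hq.1)
  obtain ⟨q₁, hq₁, hb₁⟩ := hne
  obtain ⟨q, hq, hI, hd⟩ := exists_channel_of_approx (p := p) hδ (a := a) (b := b) fun γ hγ => by
    have hne' : (infoNats p '' {q ∈ channels S H | cost p δ q ≤ b}).Nonempty :=
      ⟨_, q₁, ⟨hq₁, hb₁⟩, rfl⟩
    obtain ⟨_, ⟨q, hq, rfl⟩, hlt⟩ := exists_lt_of_csInf_lt hne' (lt_add_of_pos_right a hγ)
    exact ⟨q, hq.1, hlt.le, hq.2.trans (by linarith)⟩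
  exact ⟨q, hq, hd, fun q' hq' hd' => hI.trans (csInf_le hbdd ⟨q', ⟨hq', hd'⟩, rfl⟩)⟩

end converse

end ConceptComm

namespace ConceptProblem

open ConceptComm

/-! ### Semantic distortion as an expected cost per letter -/

section

variable {C X Y H : Type*} {m : ℕ} (P : ConceptProblem C X Y H m)

/-- The true loss of the model `h` on the concept `c`. -/
noncomputable def modelLoss (c : C) (h : H) : ℝ := expect (P.exampleLaw c) (P.loss c h)

/-- The expected true loss of the model `h`, given the dataset `s`. -/
noncomputable def posteriorLoss (s : Fin m → X × Y) (h : H) : ℝ :=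
  expect (condSnd (P.conceptDataLaw.map Prod.swap) s) fun c => P.modelLoss c h

theorem isBdd_loss (c : C) (h : H) : IsBdd (P.loss c h) :=
  .of_mem_Icc fun z => ⟨P.loss_nonneg c h z, P.loss_le_one c h z⟩

theorem modelLoss_mem_Icc (c : C) (h : H) : 0 ≤ P.modelLoss c h ∧ P.modelLoss c h ≤ 1 :=
  expect_mem_Icc fun z => ⟨P.loss_nonneg c h z, P.loss_le_one c h z⟩

theorem posteriorLoss_mem_Icc (s : Fin m → X × Y) (h : H) :
    0 ≤ P.posteriorLoss s h ∧ P.posteriorLoss s h ≤ 1 :=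
  expect_mem_Icc fun c => P.modelLoss_mem_Icc c h

theorem isBdd_posteriorLoss :
    IsBdd fun x : (Fin m → X × Y) × H => P.posteriorLoss x.1 x.2 :=
  .of_mem_Icc fun x => P.posteriorLoss_mem_Icc x.1 x.2

theorem nonempty_model (P : ConceptProblem C X Y H m) : Nonempty H :=
  (P.learner fun _ => ((P.exampleLaw P.conceptLaw.support_nonempty.some).support_nonempty.some)).support_nonempty.to_type

variable [Fintype H]

theorem trueLoss_eq_sum (c : C) (Q : PMF H) :
    P.trueLoss c Q = ∑ h, (Q h).toReal * P.modelLoss c h := by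
  simp only [trueLoss, modelLoss, ← expect_const_mul]
  rw [← expect_sum fun h _ => (IsBdd.const _).mul (P.isBdd_loss c h)]
  simp only [funext fun z => show P.beliefLoss c Q z = ∑ h, (Q h).toReal * P.loss c h z from
    expect_fintype]

theorem trueLoss_mem_Icc (c : C) (Q : PMF H) : 0 ≤ P.trueLoss c Q ∧ P.trueLoss c Q ≤ 1 := by
  rw [trueLoss_eq_sum]
  exact channel_sum_mul_mem_Icc (toReal_mem_channels fun _ : Unit => Q) (s := ())
    (P.modelLoss_mem_Icc c)

theorem isBdd_trueLoss (Q : (Fin m → X × Y) → PMF H) :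
    IsBdd fun cs : C × (Fin m → X × Y) => P.trueLoss cs.1 (Q cs.2) :=
  .of_mem_Icc fun cs => P.trueLoss_mem_Icc cs.1 (Q cs.2)

/-- The expected true loss of the belief `Q`. -/
noncomputable def meanLoss (Q : (Fin m → X × Y) → PMF H) : ℝ :=
  cost P.dataLaw P.posteriorLoss fun s h => (Q s h).toReal

theorem expect_trueLoss (Q : (Fin m → X × Y) → PMF H) :
    expect P.conceptDataLaw (fun cs => P.trueLoss cs.1 (Q cs.2)) = P.meanLoss Q := by
  have hb : IsBdd fun sc : (Fin m → X × Y) × C => P.trueLoss sc.2 (Q sc.1) :=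
    (P.isBdd_trueLoss Q).comp Prod.swap
  have hfst : (P.conceptDataLaw.map Prod.swap).map Prod.fst = P.dataLaw := by
    rw [PMF.map_comp]
    rfl
  have h1 := expect_map (p := P.conceptDataLaw) (k := Prod.swap) hb
  rw [← joint_map_fst_condSnd (P.conceptDataLaw.map Prod.swap), hfst, expect_joint hb] at h1
  change _ = expect P.conceptDataLaw (fun cs => P.trueLoss cs.1 (Q cs.2)) at h1
  rw [← h1, meanLoss, cost]
  congr 1
  funext s
  simp only [trueLoss_eq_sum, posteriorLoss]
  rw [expect_sum fun h _ => (IsBdd.const _).mul (.of_mem_Icc fun c => P.modelLoss_mem_Icc c h)]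
  simp only [expect_const_mul]

theorem dSem_eq (Q Qhat : (Fin m → X × Y) → PMF H) :
    P.dSem Q Qhat = P.meanLoss Qhat - P.meanLoss Q := by
  rw [dSem, expect_sub (P.isBdd_trueLoss Qhat) (P.isBdd_trueLoss Q), expect_trueLoss,
    expect_trueLoss]

theorem mem_testChannels {ε : ℝ} {Qt : (Fin m → X × Y) → PMF H} :
    Qt ∈ P.testChannels ε ↔ cost P.dataLaw P.posteriorLoss (fun s h => (Qt s h).toReal) ≤
      ε + P.meanLoss P.learner := by
  change P.dSem P.learner Qt ≤ ε ↔ P.meanLoss Qt ≤ _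
  rw [dSem_eq, sub_le_iff_le_add]

theorem channelInfo_eq (Qt : (Fin m → X × Y) → PMF H) :
    P.channelInfo Qt = infoNats P.dataLaw (fun s h => (Qt s h).toReal) / Real.log 2 :=
  mutualInfo_joint Qt

/-- Under the conditional law of `Ĥᵢ` given `Sᵢ`, costs are those of the pair `(Sᵢ, Ĥᵢ)`. -/
theorem cost_inducedBelief {R : ℝ} {n : ℕ} (code : Code (Fin m → X × Y) H R n) (i : Fin n)
    {g : (Fin m → X × Y) → H → ℝ} (hg : IsBdd fun x : (Fin m → X × Y) × H => g x.1 x.2) :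
    cost P.dataLaw g (fun s h => (P.inducedBelief code i s h).toReal) =
      expect (iid P.dataLaw n) fun s => g (s i) (code.decode (code.encode s) i) := by
  have hmarg : P.inducedMarginal code i =
      (iid P.dataLaw n).map fun s => (s i, code.decode (code.encode s) i) := by
    rw [inducedMarginal, inducedLaw, PMF.map_comp]
    rfl
  have hfst : (P.inducedMarginal code i).map Prod.fst = P.dataLaw := by
    rw [hmarg, PMF.map_comp]
    exact map_eval_iid n i
  have h1 := joint_map_fst_condSnd (P.inducedMarginal code i)
  rw [hfst] at h1
  calc cost P.dataLaw g (fun s h => (P.inducedBelief code i s h).toReal)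
      = expect P.dataLaw fun s => expect (P.inducedBelief code i s) fun h => g s h := by
        simp only [cost, expect_fintype]
    _ = expect (P.inducedMarginal code i) fun x => g x.1 x.2 := by
        rw [← h1, expect_joint hg, inducedBelief]
    _ = _ := by rw [hmarg, expect_map hg]

/-- The channel that a code induces on average over the letters. -/
noncomputable def codeChannel {R : ℝ} {n : ℕ} (code : Code (Fin m → X × Y) H R n) :
    (Fin m → X × Y) → H → ℝ :=
  avgChannel fun i s h => (P.inducedBelief code i s h).toReal

theorem codeChannel_mem {R : ℝ} {n : ℕ} (hn : n ≠ 0) (code : Code (Fin m → X × Y) H R n) :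
    P.codeChannel code ∈ channels (Fin m → X × Y) H :=
  avgChannel_mem hn fun _ => toReal_mem_channels _

theorem cost_codeChannel {R : ℝ} {n : ℕ} (code : Code (Fin m → X × Y) H R n)
    {g : (Fin m → X × Y) → H → ℝ} (hg : IsBdd fun x : (Fin m → X × Y) × H => g x.1 x.2) :
    cost P.dataLaw g (P.codeChannel code) = (n : ℝ)⁻¹ * expect (iid P.dataLaw n) fun s =>
      ∑ i, g (s i) (code.decode (code.encode s) i) := by
  rw [codeChannel, cost_avgChannel (fun _ => toReal_mem_channels _) hg,
    expect_sum fun i _ => hg.comp fun s : Fin n → Fin m → X × Y =>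
      (s i, code.decode (code.encode s) i)]
  simp only [P.cost_inducedBelief code _ hg]

theorem codeDistortion_eq {R : ℝ} {n : ℕ} (hn : n ≠ 0) (code : Code (Fin m → X × Y) H R n) :
    P.codeDistortion code =
      cost P.dataLaw P.posteriorLoss (P.codeChannel code) - P.meanLoss P.learner := by
  rw [codeDistortion, dAvg, codeChannel, cost_avgChannel (fun _ => toReal_mem_channels _)
    P.isBdd_posteriorLoss, one_div]
  simp only [dSem_eq, Finset.sum_sub_distrib, Finset.sum_const, Finset.card_univ, Fintype.card_fin,
    nsmul_eq_mul, mul_sub]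
  rw [inv_mul_cancel_left₀ (by exact_mod_cast hn)]
  rfl

/-! ### Achievability -/

theorem exists_le_le_add_one {u : ℕ → ℝ} {A : ℝ} {n : ℕ} (h0 : u 0 ≤ A) (hn : A ≤ u n)
    (hu : ∀ k, u (k + 1) ≤ u k + 1) : ∃ k, u k ≤ A ∧ A ≤ u k + 1 := by
  by_contra! hcon
  have hall : ∀ k, u k ≤ A := fun k => by
    induction k with
    | zero => exact h0
    | succ k ih => exact (hu k).trans (hcon k ih).le
  have := hcon n (hall n)
  linarith

theorem natFloor_pos {R : ℝ} (hR : 0 ≤ R) (n : ℕ) : 0 < ⌊(2 : ℝ) ^ ((n : ℝ) * R)⌋₊ :=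
  Nat.floor_pos.2 (Real.one_le_rpow one_le_two (by positivity))

/-- Given a code of small cost, replacing its first `k` reconstructed letters by a fixed letter of
larger cost changes the total cost by at most `1` per letter, so that some `k` brings the cost
close to any target value in between. -/
theorem exists_code_near {R T b : ℝ} {n : ℕ} (hn : n ≠ 0) (hR : 0 ≤ R) (h₀ : H)
    (hb : expect P.dataLaw (fun s => P.posteriorLoss s h₀) = b)
    (hcode : ∃ code : Code (Fin m → X × Y) H R n,
      expect (iid P.dataLaw n) (fun s =>
        ∑ i, P.posteriorLoss (s i) (code.decode (code.encode s) i)) ≤ n * T) :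
    ∃ code : Code (Fin m → X × Y) H R n,
      |P.codeDistortion code - (min T b - P.meanLoss P.learner)| ≤ 1 / n := by
  have hn0 : (0 : ℝ) < n := by exact_mod_cast Nat.pos_of_ne_zero hn
  have hbd : ∀ d : (Fin n → Fin m → X × Y) → Fin n → H, ∀ i,
      IsBdd fun s : Fin n → Fin m → X × Y => P.posteriorLoss (s i) (d s i) := fun d i =>
    P.isBdd_posteriorLoss.comp fun s : Fin n → Fin m → X × Y => (s i, d s i)
  have hconst : expect (iid P.dataLaw n) (fun s => ∑ i, P.posteriorLoss (s i) h₀) = n * b := by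
    rw [expect_sum fun i _ => hbd (fun _ _ => h₀) i]
    simp only [expect_iid_eval _ (IsBdd.of_mem_Icc fun s => P.posteriorLoss_mem_Icc s h₀), hb,
      Finset.sum_const, Finset.card_univ, Fintype.card_fin, nsmul_eq_mul]
  rcases le_total T b with hTb | hbT
  · obtain ⟨⟨enc, dec⟩, hle⟩ := hcode
    set d : ℕ → Fin ⌊(2 : ℝ) ^ ((n : ℝ) * R)⌋₊ → Fin n → H := fun k j i =>
      if (i : ℕ) < k then h₀ else dec j i with hd
    set u : ℕ → ℝ := fun k =>
      expect (iid P.dataLaw n) fun s => ∑ i, P.posteriorLoss (s i) (d k (enc s) i) with hu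
    obtain ⟨k, hk1, hk2⟩ := exists_le_le_add_one (u := u) (A := n * T) (n := n)
      (by simpa [hu, hd] using hle)
      (by
        have h1 : u n = n * b := by simpa [hu, hd] using hconst
        rw [h1]
        exact mul_le_mul_of_nonneg_left hTb hn0.le)
      (fun k => by
        have h1 : u k + 1 = expect (iid P.dataLaw n) fun s =>
            (∑ i, P.posteriorLoss (s i) (d k (enc s) i)) + 1 := by
          rw [expect_add (.sum fun i _ => hbd (fun s => d k (enc s)) i) (.const 1), expect_const]
        rw [h1]
        refine expect_mono (.sum fun i _ => hbd (fun s => d (k + 1) (enc s)) i)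
          ((IsBdd.sum fun i _ => hbd (fun s => d k (enc s)) i).add (.const 1)) fun s _ => ?_
        rw [← sub_le_iff_le_add', ← Finset.sum_sub_distrib]
        -- Only the letter of index `k` changes.
        calc ∑ i, (P.posteriorLoss (s i) (d (k + 1) (enc s) i) -
              P.posteriorLoss (s i) (d k (enc s) i))
            ≤ ∑ i : Fin n, if (i : ℕ) = k then (1 : ℝ) else 0 := by
              refine Finset.sum_le_sum fun i _ => ?_
              split_ifs with hik
              · linarith [(P.posteriorLoss_mem_Icc (s i) (d (k + 1) (enc s) i)).2,
                  (P.posteriorLoss_mem_Icc (s i) (d k (enc s) i)).1]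
              · have : d (k + 1) (enc s) i = d k (enc s) i := by
                  simp only [hd]
                  congr 1
                  exact propext (by omega)
                rw [this, sub_self]
          _ ≤ 1 := by
              rw [Finset.sum_boole]
              exact_mod_cast Finset.card_le_one.2 fun i hi j hj => Fin.ext (by
                simp only [Finset.mem_filter, Finset.mem_univ, true_and] at hi hj
                omega))
    refine ⟨⟨enc, d k⟩, ?_⟩
    rw [P.codeDistortion_eq hn, P.cost_codeChannel _ P.isBdd_posteriorLoss, min_eq_left hTb,
      sub_sub_sub_cancel_right]
    change |(n : ℝ)⁻¹ * u k - T| ≤ 1 / n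
    have h1 : (n : ℝ)⁻¹ * u k - T = (u k - n * T) / n := by field_simp
    rw [h1, abs_div, abs_of_pos hn0]
    gcongr
    exact abs_le.2 ⟨by linarith, by linarith⟩
  · refine ⟨⟨fun _ => ⟨0, natFloor_pos hR n⟩, fun _ _ => h₀⟩, ?_⟩
    rw [P.codeDistortion_eq hn, P.cost_codeChannel _ P.isBdd_posteriorLoss, min_eq_right hbT,
      hconst, inv_mul_cancel_left₀ hn0.ne', sub_self, abs_zero]
    positivity

theorem achievable_of_lt {q : (Fin m → X × Y) → H → ℝ} (hq : q ∈ channels (Fin m → X × Y) H)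
    {R ε : ℝ} (hI : infoNats P.dataLaw q < R * Real.log 2)
    (hd : cost P.dataLaw P.posteriorLoss q < ε + P.meanLoss P.learner) : P.Achievable R ε := by
  have : Nonempty H := P.nonempty_model
  have hlog : 0 < Real.log 2 := Real.log_pos one_lt_two
  obtain ⟨T, hT, hTε⟩ := exists_between hd
  obtain ⟨hR0, hev⟩ := eventually_exists_code hq P.posteriorLoss_mem_Icc hI hT
  have hR : 0 ≤ R := by
    by_contra! hneg
    nlinarith
  set h₀ : H := Classical.arbitrary H
  set b := expect P.dataLaw fun s => P.posteriorLoss s h₀ with hb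
  obtain ⟨N, hN⟩ := Filter.eventually_atTop.1 (hev.and (Filter.eventually_ne_atTop 0))
  have hex : ∀ n : ℕ, ∃ code : Code (Fin m → X × Y) H R n, N ≤ n →
      |P.codeDistortion code - (min T b - P.meanLoss P.learner)| ≤ 1 / n := by
    intro n
    by_cases hn : N ≤ n
    · obtain ⟨enc, dec, hle⟩ := (hN n hn).1 ⌊(2 : ℝ) ^ ((n : ℝ) * R)⌋₊ (by
        rw [show (n : ℝ) * (R * Real.log 2) = Real.log 2 * (n * R) by ring, Real.exp_mul,
          Real.exp_log two_pos]
        exact (Nat.lt_floor_add_one _).le)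
      obtain ⟨code, hcode⟩ := P.exists_code_near (hN n hn).2 hR h₀ hb.symm ⟨⟨enc, dec⟩, hle⟩
      exact ⟨code, fun _ => hcode⟩
    · exact ⟨⟨fun _ => ⟨0, natFloor_pos hR n⟩, fun _ _ => h₀⟩, fun h => absurd h hn⟩
  choose code hcode using hex
  refine ⟨code, min T b - P.meanLoss P.learner, ?_, ?_⟩
  · linarith [min_le_left T b]
  · rw [tendsto_iff_dist_tendsto_zero]
    refine squeeze_zero' (.of_forall fun n => dist_nonneg) ?_ tendsto_one_div_atTop_nhds_zero_nat
    filter_upwards [Filter.eventually_ge_atTop N] with n hn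
    rw [Real.dist_eq]
    exact hcode n hn

theorem mem_region_of_le {q : (Fin m → X × Y) → H → ℝ} (hq : q ∈ channels (Fin m → X × Y) H)
    {R ε : ℝ} (hI : infoNats P.dataLaw q ≤ R * Real.log 2)
    (hd : cost P.dataLaw P.posteriorLoss q ≤ ε + P.meanLoss P.learner) : (R, ε) ∈ P.region := by
  have hlog : 0 < Real.log 2 := Real.log_pos one_lt_two
  refine Metric.mem_closure_iff.2 fun γ hγ => ⟨(R + γ / 2, ε + γ / 2), ?_, ?_⟩
  · refine P.achievable_of_lt hq ?_ ?_
    · rw [add_mul]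
      exact lt_add_of_le_of_pos hI (by positivity)
    · linarith
  · rw [Prod.dist_eq]
    simp only [dist_self_add_right, Real.norm_eq_abs, max_self]
    rw [abs_of_pos (by positivity)]
    linarith

/-! ### Converse for the rate-distortion region -/

theorem exists_channel_of_mem_region {R ε : ℝ} (h : (R, ε) ∈ P.region) :
    ∃ q ∈ channels (Fin m → X × Y) H, infoNats P.dataLaw q ≤ R * Real.log 2 ∧
      cost P.dataLaw P.posteriorLoss q ≤ ε + P.meanLoss P.learner := by
  have : Nonempty H := P.nonempty_model
  refine exists_channel_of_approx P.posteriorLoss_mem_Icc fun γ hγ => ?_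
  obtain ⟨⟨R₁, ε₁⟩, ⟨code, D, hD, hlim⟩, hdist⟩ := Metric.mem_closure_iff.1 h (γ / 2) (half_pos hγ)
  rw [Prod.dist_eq, max_lt_iff, Real.dist_eq, Real.dist_eq] at hdist
  obtain ⟨hdR, hdε⟩ := hdist
  obtain ⟨n, hnD, hn⟩ :=
    ((hlim.eventually_lt_const hD).and (Filter.eventually_ne_atTop 0)).exists
  have hn0 : (0 : ℝ) < n := by exact_mod_cast Nat.pos_of_ne_zero hn
  have hq := P.codeChannel_mem hn (code n)
  have hη : 0 < min 1 (γ / 2) := lt_min one_pos (half_pos hγ)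
  refine ⟨mixUniform (min 1 (γ / 2)) (P.codeChannel (code n)),
    mixUniform_mem hq hη.le (min_le_left _ _), ?_, ?_⟩
  · have h1 := mul_infoNats_le_log hq hn (code n).encode (code n).decode
      (fun g hg => P.cost_codeChannel (code n) hg) hη (min_le_left _ _)
    have hM : 0 < ⌊(2 : ℝ) ^ ((n : ℝ) * R₁)⌋₊ := by
      have : Nonempty (Fin m → X × Y) := P.dataLaw.support_nonempty.to_type
      exact ((code n).encode fun _ => Classical.arbitrary _).pos
    have h2 : Real.log ⌊(2 : ℝ) ^ ((n : ℝ) * R₁)⌋₊ ≤ n * (R₁ * Real.log 2) := by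
      rw [← mul_assoc, ← Real.log_rpow two_pos]
      exact Real.log_le_log (by exact_mod_cast hM) (Nat.floor_le (by positivity))
    have h3 := le_of_mul_le_mul_left (h1.trans h2) hn0
    have h4 : Real.log 2 ≤ 1 := by linarith [Real.log_two_lt_d9]
    have h5 : 0 < Real.log 2 := Real.log_pos one_lt_two
    have h6 := (abs_lt.1 hdR).1
    dsimp only at h6
    nlinarith
  · refine (cost_mixUniform_le hq P.posteriorLoss_mem_Icc hη.le).trans ?_
    rw [P.codeDistortion_eq hn] at hnD
    have h1 := min_le_right 1 (γ / 2)
    have h2 := (abs_lt.1 hdε).1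
    dsimp only at h2
    linarith

end

end ConceptProblem

theorem theorem1 {C X Y H : Type*} [Finite H] {m : ℕ} (P : ConceptProblem C X Y H m) (ε : ℝ) :
    ((P.testChannels ε).Nonempty →
      ∃ r : ℝ, IsLeast (P.channelInfo '' P.testChannels ε) r ∧ P.rateDistortion ε = (r : EReal)) ∧
    (P.testChannels ε = ∅ → P.rateDistortion ε = ⊤) := by
  have := Fintype.ofFinite H
  have hlog : 0 < Real.log 2 := Real.log_pos one_lt_two
  -- A rate in the region is at least the information of some test channel.
  have hconv : ∀ R : ℝ, (R, ε) ∈ P.region → ∃ Qt ∈ P.testChannels ε, P.channelInfo Qt ≤ R := by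
    intro R hR
    obtain ⟨q, hq, hI, hd⟩ := P.exists_channel_of_mem_region hR
    obtain ⟨Qt, rfl⟩ := ConceptComm.exists_pmf_of_mem_channels hq
    refine ⟨Qt, P.mem_testChannels.2 hd, ?_⟩
    rw [P.channelInfo_eq, div_le_iff₀ hlog]
    exact hI
  refine ⟨fun hne => ?_, fun hempty => ?_⟩
  · obtain ⟨Q₁, hQ₁⟩ := hne
    obtain ⟨q, hq, hd, hmin⟩ := ConceptComm.exists_isMinOn_infoNats (p := P.dataLaw)
      P.posteriorLoss_mem_Icc
      ⟨_, ConceptComm.toReal_mem_channels Q₁, P.mem_testChannels.1 hQ₁⟩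
    obtain ⟨Qt, hQt⟩ := ConceptComm.exists_pmf_of_mem_channels hq
    subst hQt
    have hleast : ∀ Q' ∈ P.testChannels ε, P.channelInfo Qt ≤ P.channelInfo Q' := fun Q' hQ' => by
      rw [P.channelInfo_eq, P.channelInfo_eq]
      exact div_le_div_of_nonneg_right (hmin _ (ConceptComm.toReal_mem_channels Q')
        (P.mem_testChannels.1 hQ')) hlog.le
    refine ⟨P.channelInfo Qt, ⟨⟨Qt, P.mem_testChannels.2 hd, rfl⟩, ?_⟩, le_antisymm ?_ ?_⟩
    · rintro _ ⟨Q', hQ', rfl⟩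
      exact hleast Q' hQ'
    · refine sInf_le ⟨_, rfl, P.mem_region_of_le hq ?_ hd⟩
      rw [P.channelInfo_eq, div_mul_cancel₀ _ hlog.ne']
    · refine le_sInf ?_
      rintro _ ⟨R, rfl, hR⟩
      obtain ⟨Q', hQ', hle⟩ := hconv R hR
      exact EReal.coe_le_coe_iff.2 ((hleast Q' hQ').trans hle)
  · rw [ConceptProblem.rateDistortion, sInf_eq_top]
    rintro _ ⟨R, rfl, hR⟩
    obtain ⟨Q', hQ', -⟩ := hconv R hR
    rw [hempty] at hQ'
    exact absurd hQ' (Set.notMem_empty _)
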